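/- **Setting.** Let $d\ge 2$, $1\le N\le d$, $\tau\ge 1$, $K\ge1$, $x^*\in\mathbb R^d$, $\tau^*=\|x^*\|_0$, $s=2\tau+\tau^*$. Client $i\in[N]$ holds $B$ observations $(z_{i,j},y_{i,j})$, all independent, with $z_{i,j}\in\mathbb R^d$ drawn from a law $\mathcal D_i$ and $y_{i,j}\in\{0,1\}$, $\mathbb P(y_{i,j}=1\mid z_{i,j})=\frac{\exp(z_{i,j}^Tx^*)}{1+\exp(z_{i,j}^Tx^*)}$. Assume $\|z_{i,j}\|\le\mathcal K$ almost surely and $\lambda_{\min}\|v\|^2\le E_{z\sim\mathcal D_i}[(z^Tv)^2]\le\lambda_{\max}\|v\|^2$ for all $i$ and all $v$ with $\|v\|_0\le s$, where $0<\lambda_{\min}\le\lambda_{\max}$ (for isotropic features $\lambda_{\min}=\lambda_{\max}=1$). Put $f_i(x)=\frac1B\sum_{j=1}^B\big(\log(1+\exp(z_{i,j}^Tx))-y_{i,j}z_{i,j}^Tx\big)$ and $f=\frac1N\sum_i f_i$. **Algorithm (FedIter-HT).** Let $\mathcal H_\tau$ keep the $\tau$ entries of largest absolute value and set the others to $0$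 (ties are broken by index). From $x_0$ with $\|x_0\|_0\le\tau$, in round $t$ every client sets $x_{t,0}^{(i)}=x_t$ and makes $K$ steps $x_{t,k+1}^{(i)}=\mathcal H_\tau(x_{t,k}^{(i)}-\gamma g_{t,k}^{(i)})$, where $g_{t,k}^{(i)}$ is the gradient at $x_{t,k}^{(i)}$ of the average loss over a minibatch of $b_t$ observations of client $i$, drawn independently and uniformly with replacement; then $x_{t+1}=\mathcal H_\tau(\frac1N\sum_i x_{t,K}^{(i)})$. Let $0<C_{lower}\le C_{upper}$, $\rho_s=\frac45C_{lower}\lambda_{\min}$, $l_s=\frac65C_{upper}\lambda_{\max}$, $\kappa_s=l_s/\rho_s$, $\alpha=\frac{2\sqrt{\tau^*}}{\sqrt{\tau-\tau^*}}$ (read as $0$ if $\tau^*=0$), $\theta=(1+2\alpha)^2(1-\frac1{12\kappa_s})$. Assume $\theta<1$, $\tau\ge\Big(\frac{16}{(\sqrt{12\kappa_s/(12\kappa_s-1)}-1)^2}+1\Big)\tau^*$, $\gamma=\frac1{6l_s}$, and $b_t=\lceil\Gamma/\theta^t\rceil$ with $\Gamma>0$. **Conditions on data and runs.** For $\mathcal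 B>1$, the data are *$\mathcal B$-dissimilar* if $\frac1N\sum_i\|\pi_{\mathcal I}(\nabla f_i(x^*))\|^2\le\mathcal B^2\|\pi_{\mathcal I}(\nabla f(x^*))\|^2$ for all $\mathcal I\subseteq[d]$, where $\pi_{\mathcal I}$ keeps the entries indexed by $\mathcal I$. Let $G_T$ be the event (over the minibatches) that $C_{lower}\le\frac{\exp(z_{i,j}^Tx)}{(1+\exp(z_{i,j}^Tx))^2}\le C_{upper}$ for all $i,j$ and all $x$ on the segments from $x^*$ to the local iterates $x_{t,k}^{(i)}$, $0\le t<T$, $0\le k<K$. **Claim.** There are universal constants $C_6,C_9,C_{10}>0$, a constant $C_7>0$ depending only on $\lambda_{\min},\lambda_{\max}$, and a constant $C>0$ depending only on $\lambda_{\min},\lambda_{\max},C_{lower},C_{upper}$, such that the following holds whenever $B\ge C_7\tau\mathcal K^2\log d$. There is a $T_0$, not depending on the data, such that with probability at least $$1-\exp(-C_6NB)-C_9\exp(-C_{10}\log d)+\frac{C_9}{\exp(C_6NB)\exp(C_{10}\log d)}$$ over the data, if the data are $\mathcal B$-dissimilar, then for all $T\ge T_0$, with $E$ the expectation over the minibatches,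 $$E\big[\|x_T-x^*\|^2\,\mathbb 1_{G_T}\big]\le C\,\frac{(2N\tau+\tau^*)\,\mathcal B^2\mathcal K^2\log d}{NB};$$ in particular $E[\|x_T-x^*\|^2]$ satisfies the same bound if the curvature condition $G_T$ holds for every choice of the minibatches. -/

import Mathlib

open MeasureTheory ProbabilityTheory
open scoped BigOperators Gradient

namespace FedLogistic

/-- The parameter space `ℝ^d` with the Euclidean norm. -/
abbrev Vec (d : ℕ) : Type := EuclideanSpace ℝ (Fin d)

/-- `‖x‖₀`, the number of nonzero entries. -/
noncomputable def l0 {d : ℕ} (x : Vec d) : ℕ :=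
  (Finset.univ.filter (fun l : Fin d => x l ≠ 0)).card

/-- The projector `π_I` that keeps the entries indexed by `I` and zeroes the others. -/
noncomputable def proj {d : ℕ} (I : Finset (Fin d)) (x : Vec d) : Vec d :=
  WithLp.toLp 2 (fun l => if l ∈ I then x l else 0)

/-- The hard thresholding operator `H_τ`: it keeps the `τ` entries of largest absolute value and
zeroes the others; of entries with equal absolute value those with smaller index are
kept first. -/
noncomputable def hardThreshold {d : ℕ} (τ : ℕ) (x : Vec d) : Vec d :=
  WithLp.toLp 2 (fun l =>
    if (Finset.univ.filter
        (fun m : Fin d => |x l| < |x m| ∨ (|x m| = |x l| ∧ m < l))).card < τ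
    then x l else 0)

/-! ### The logistic model and its data -/

/-- The success probability `exp u / (1 + exp u)`. -/
noncomputable def logisticProb (u : ℝ) : ℝ := Real.exp u / (1 + Real.exp u)

/-- The logistic curvature `exp u / (1 + exp u)^2`. -/
noncomputable def logisticCurv (u : ℝ) : ℝ := Real.exp u / (1 + Real.exp u) ^ 2

theorem logisticProb_nonneg (u : ℝ) : 0 ≤ logisticProb u := by
  unfold logisticProb; positivity

theorem logisticProb_le_one (u : ℝ) : logisticProb u ≤ 1 := by
  unfold logisticProb
  rw [div_le_one (by positivity)]
  linarith

theorem continuous_logisticProb : Continuous logisticProb := by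
  unfold logisticProb
  exact Real.continuous_exp.div (by fun_prop) (fun u => by positivity)

/-- The conditional law of the label given the feature `z`: the label is `1` with probability
`exp(zᵀx*) / (1 + exp(zᵀx*))`, and `0` otherwise. -/
noncomputable def labelKernel {d : ℕ} (xstar : Vec d) : Kernel (Vec d) ℝ where
  toFun z := ENNReal.ofReal (logisticProb (inner ℝ z xstar)) • Measure.dirac (1 : ℝ)
    + ENNReal.ofReal (1 - logisticProb (inner ℝ z xstar)) • Measure.dirac (0 : ℝ)
  measurable' := by
    have h : Measurable (fun z : Vec d => logisticProb (inner ℝ z xstar)) :=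
      (continuous_logisticProb.comp (by fun_prop)).measurable
    refine Measure.measurable_of_measurable_coe _ (fun s _ => ?_)
    simp only [Measure.coe_add, Measure.coe_smul, Pi.add_apply, Pi.smul_apply, smul_eq_mul]
    exact (h.ennreal_ofReal.mul_const _).add ((measurable_const.sub h).ennreal_ofReal.mul_const _)

instance {d : ℕ} (xstar : Vec d) : IsMarkovKernel (labelKernel xstar) where
  isProbabilityMeasure z := by
    refine ⟨?_⟩
    have h0 := logisticProb_nonneg (inner ℝ z xstar)
    have h1 := logisticProb_le_one (inner ℝ z xstar)
    change (ENNReal.ofReal (logisticProb (inner ℝ z xstar)) • Measure.dirac (1 : ℝ)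
      + ENNReal.ofReal (1 - logisticProb (inner ℝ z xstar)) • Measure.dirac (0 : ℝ)) Set.univ = 1
    simp only [Measure.coe_add, Measure.coe_smul, Pi.add_apply, Pi.smul_apply, smul_eq_mul,
      measure_univ, mul_one]
    rw [← ENNReal.ofReal_add h0 (by linarith)]
    simp

/-- The law of one observation `(z, y)` of a client with feature distribution `D`. -/
noncomputable def obsLaw {d : ℕ} (D : Measure (Vec d)) (xstar : Vec d) : Measure (Vec d × ℝ) :=
  D ⊗ₘ labelKernel xstar

/-- The law of the data `(z_{i,j}, y_{i,j})`: all observations are independent, and those of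
client `i` have features drawn from `D i`. -/
noncomputable def dataLaw {d N : ℕ} (B : ℕ) (D : Fin N → Measure (Vec d)) (xstar : Vec d) :
    Measure (Fin N → Fin B → Vec d × ℝ) :=
  Measure.pi (fun i => Measure.pi (fun _ => obsLaw (D i) xstar))

/-- The loss `log(1 + exp(zᵀx)) - y zᵀx` of one observation. -/
noncomputable def obsLoss {d : ℕ} (o : Vec d × ℝ) (x : Vec d) : ℝ :=
  Real.log (1 + Real.exp (inner ℝ o.1 x)) - o.2 * inner ℝ o.1 x

/-- The average loss of the observations with indices `I 0, …, I (m - 1)`. -/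
noncomputable def batchLoss {d B m : ℕ} (data : Fin B → Vec d × ℝ) (I : Fin m → Fin B)
    (x : Vec d) : ℝ :=
  (1 / (m : ℝ)) * ∑ r, obsLoss (data (I r)) x

/-- The local objective `f_i`. -/
noncomputable def clientLoss {d B : ℕ} (data : Fin B → Vec d × ℝ) (x : Vec d) : ℝ :=
  (1 / (B : ℝ)) * ∑ j, obsLoss (data j) x

/-- The global objective `f = (1/N) ∑ f_i`. -/
noncomputable def globalLoss {d N B : ℕ} (data : Fin N → Fin B → Vec d × ℝ) (x : Vec d) : ℝ :=
  (1 / (N : ℝ)) * ∑ i, clientLoss (data i) x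

/-- The local objectives are `Bdis`-locally dissimilar at `x`. -/
def LocallyDissimilarAt {d N B : ℕ} (data : Fin N → Fin B → Vec d × ℝ) (Bdis : ℝ)
    (x : Vec d) : Prop :=
  ∀ I : Finset (Fin d),
    ∑ i, (1 / (N : ℝ)) * ‖proj I (∇ (clientLoss (data i)) x)‖ ^ 2
      ≤ Bdis ^ 2 * ‖proj I (∇ (globalLoss data) x)‖ ^ 2

/-! ### The algorithm -/

/-- `k` local steps of a client, from `x`, with minibatches `S 0, …, S (k - 1)` of size `m`:
each step is a minibatch gradient step of length `γ` followed by hard thresholding. -/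
noncomputable def localIterate {d B m : ℕ} (τ : ℕ) (γ : ℝ) (data : Fin B → Vec d × ℝ) :
    (k : ℕ) → (Fin k → Fin m → Fin B) → Vec d → Vec d
  | 0, _, x => x
  | k + 1, S, x =>
      hardThreshold τ
        (localIterate τ γ data k (fun l => S l.castSucc) x
          - γ • ∇ (batchLoss data (S (Fin.last k)))
              (localIterate τ γ data k (fun l => S l.castSucc) x))

/-- All minibatches of the first `T` rounds: for each round `t`, client `i` and local step `k`, a
list of `b t` indices in `Fin B`. A uniformly random element of this finite type consists of
independent minibatches, each drawn uniformly with replacement. -/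
abbrev Batches (N B K : ℕ) (b : ℕ → ℕ) (T : ℕ) : Type :=
  (t : Fin T) → Fin N → Fin K → Fin (b t) → Fin B

/-- The server iterate `x_T` of FedIter-HT with `K` local steps per round, equal client weights
and minibatches `S`. -/
noncomputable def fedIterHT {d N B : ℕ} (τ K : ℕ) (γ : ℝ) (b : ℕ → ℕ)
    (data : Fin N → Fin B → Vec d × ℝ) (x0 : Vec d) : (T : ℕ) → Batches N B K b T → Vec d
  | 0, _ => x0
  | T + 1, S =>
      hardThreshold τ
        (∑ i, (1 / (N : ℝ)) • localIterate τ γ (data i) K (S (Fin.last T) i)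
          (fedIterHT τ K γ b data x0 T (fun t => S t.castSucc)))

/-- The local iterate `x_{t,k}^{(i)}` (`0 ≤ k < K`) of a run with minibatches `S`. -/
noncomputable def localPoint {d N B : ℕ} (τ K : ℕ) (γ : ℝ) (b : ℕ → ℕ)
    (data : Fin N → Fin B → Vec d × ℝ) (x0 : Vec d) {T : ℕ} (S : Batches N B K b T)
    (t : Fin T) (i : Fin N) (k : Fin K) : Vec d :=
  localIterate τ γ (data i) k (fun l => S t i (l.castLE k.isLt.le))
    (fedIterHT τ K γ b data x0 t (fun r => S (r.castLE t.isLt.le)))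

/-- The curvature condition along the run with minibatches `S`:
`Clow ≤ exp(z_{i,j}ᵀx) / (1 + exp(z_{i,j}ᵀx))^2 ≤ Cup` for all clients `i`, all `j`, and all `x` on
the segments from `xstar` to the local iterates of client `i`. -/
def CurvatureAlong {d N B : ℕ} (Clow Cup : ℝ) (xstar : Vec d) (τ K : ℕ) (γ : ℝ) (b : ℕ → ℕ)
    (data : Fin N → Fin B → Vec d × ℝ) (x0 : Vec d) {T : ℕ} (S : Batches N B K b T) : Prop :=
  ∀ (t : Fin T) (i : Fin N) (k : Fin K) (j : Fin B),
    ∀ x ∈ segment ℝ xstar (localPoint τ K γ b data x0 S t i k),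
      Clow ≤ logisticCurv (inner ℝ (data i j).1 x) ∧
        logisticCurv (inner ℝ (data i j).1 x) ≤ Cup

end FedLogistic

namespace FedLogistic

/-! ### Concentration for independent observations -/

/-! The data enter through three facts, which hold together with probability at least `1 - 4 / d ^
2` (`exists_good_event`). Every client's empirical second moment lies between `4/5 * lamMin` and
`6/5 * lamMax` on vectors with at most `2τ + τ*` nonzero entries: this is a Bernstein tail at each
point of a finite net (`exists_finset_control_sparse`) and a union bound. Every squared entry of
`∇f(x*)` is at most `6 𝒦² log d / (N B)`: by `integral_obsGrad_apply` it is an average of `N B`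
independent centred bounded variables, so Hoeffding applies. Features and labels obey their almost
sure bounds.

On such data the rest is a contraction argument with `u = ρ / (12 l) = 1 / (12 κ)`. A local step
only involves the coordinates in the supports of the old iterate, the new iterate and `x*`; there
the loss behaves like a quadratic with curvature between `ρ` and `l`, so an exact gradient step
multiplies the squared distance to `x*` by at most `1 - 11u/3` (`norm_sub_proj_gradient_sq_le`).
Splitting off the error terms costs `1 + u`, and thresholding costs `H = 1 + α`
(`norm_hardThreshold_sub_sq_le`). A local step thus still contracts, and the server adds one more
factor `H`. Since `θ < 1` forces `H² (1 - u) ≤ 1`, a whole round contracts by `1 - u`.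

Two additive errors remain. The minibatch variance is at most `𝒦² / b_t`, which decays like `θ ^ t`.
The client gradients at `x*` are transferred by dissimilarity to `∇f(x*)` on a single index set of
size at most `2Nτ + τ*`, which produces the statistical error. Summing the geometric series gives
the bound once the transient has died out.

The expectation over minibatches is a uniform average over a finite product, conditioned on the past
by splitting off the last factor. The curvature event of a run implies that of each prefix, so its
indicator can be carried through the recursion. -/

theorem lintegral_pi_prod {ι : Type*} [Fintype ι] {X : ι → Type*} [∀ i, MeasurableSpace (X i)]
    (μ : ∀ i, Measure (X i)) [∀ i, IsProbabilityMeasure (μ i)] (f : ∀ i, X i → ENNReal)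
    (hf : ∀ i, Measurable (f i)) :
    ∫⁻ ω, ∏ i, f i (ω i) ∂(Measure.pi μ) = ∏ i, ∫⁻ x, f i x ∂(μ i) := by
  have hind : iIndepFun (fun i (ω : ∀ i, X i) => f i (ω i)) (Measure.pi μ) :=
    iIndepFun_pi (fun i => (hf i).aemeasurable)
  have h := lintegral_prod_eq_prod_lintegral_of_indepFun (μ := Measure.pi μ) Finset.univ
    (fun i (ω : ∀ i, X i) => f i (ω i)) hind (fun i => (hf i).comp (measurable_pi_apply i))
  rw [h]
  refine Finset.prod_congr rfl (fun i _ => ?_)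
  have hm := measurePreserving_eval μ i
  exact hm.lintegral_comp (hf i)

/-- Chernoff's bound for the sum of functions of independent observations. -/
theorem measure_pi_pi_sum_ge_le {N B : ℕ} {X : Type*} [MeasurableSpace X]
    (μ : Fin N → Measure X) [∀ i, IsProbabilityMeasure (μ i)] (φ : Fin N → X → ℝ)
    (hφ : ∀ i, Measurable (φ i)) (c : Fin N → ℝ)
    (hc : ∀ i, ∫⁻ x, ENNReal.ofReal (Real.exp (φ i x)) ∂(μ i) ≤ ENNReal.ofReal (Real.exp (c i)))
    (t : ℝ) :
    Measure.pi (fun i => Measure.pi (fun _ : Fin B => μ i))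
      {ω | t ≤ ∑ i, ∑ j, φ i (ω i j)} ≤ ENNReal.ofReal (Real.exp (B * ∑ i, c i - t)) := by
  set P := Measure.pi (fun i => Measure.pi (fun _ : Fin B => μ i))
  have hprod : ∀ ω : Fin N → Fin B → X, ENNReal.ofReal (Real.exp (∑ i, ∑ j, φ i (ω i j)))
      = ∏ i, ∏ j, ENNReal.ofReal (Real.exp (φ i (ω i j))) := by
    intro ω
    rw [Real.exp_sum, ENNReal.ofReal_prod_of_nonneg (fun _ _ => (Real.exp_pos _).le)]
    refine Finset.prod_congr rfl (fun i _ => ?_)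
    rw [Real.exp_sum, ENNReal.ofReal_prod_of_nonneg (fun _ _ => (Real.exp_pos _).le)]
  have hmeas : ∀ i, Measurable (fun x => ENNReal.ofReal (Real.exp (φ i x))) := fun i =>
    (Real.measurable_exp.comp (hφ i)).ennreal_ofReal
  have hint : ∫⁻ ω, ENNReal.ofReal (Real.exp (∑ i, ∑ j, φ i (ω i j))) ∂P
      ≤ ENNReal.ofReal (Real.exp (B * ∑ i, c i)) := by
    simp_rw [hprod]
    rw [lintegral_pi_prod (fun i => Measure.pi (fun _ : Fin B => μ i))
      (fun i (η : Fin B → X) => ∏ j, ENNReal.ofReal (Real.exp (φ i (η j))))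
      (fun i => Finset.measurable_prod _ (fun j _ => (hmeas i).comp (measurable_pi_apply j)))]
    calc _ = ∏ i, ∏ _j : Fin B, ∫⁻ x, ENNReal.ofReal (Real.exp (φ i x)) ∂(μ i) := by
          refine Finset.prod_congr rfl (fun i _ => ?_)
          exact lintegral_pi_prod (fun _ : Fin B => μ i)
            (fun _ x => ENNReal.ofReal (Real.exp (φ i x))) (fun _ => hmeas i)
      _ ≤ ∏ i, ∏ _j : Fin B, ENNReal.ofReal (Real.exp (c i)) := by
          gcongr with i _ j _
          exact hc i
      _ = _ := by
          rw [Finset.mul_sum, Real.exp_sum,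
            ENNReal.ofReal_prod_of_nonneg (fun _ _ => (Real.exp_pos _).le)]
          refine Finset.prod_congr rfl (fun i _ => ?_)
          rw [Finset.prod_const, Finset.card_univ, Fintype.card_fin, Real.exp_nat_mul,
            ENNReal.ofReal_pow (Real.exp_pos _).le]
  have hm : Measurable (fun ω : Fin N → Fin B → X => ∑ i, ∑ j, φ i (ω i j)) := by
    refine Finset.measurable_sum _ (fun i _ => Finset.measurable_sum _ (fun j _ => ?_))
    exact (hφ i).comp ((measurable_pi_apply j).comp (measurable_pi_apply i))
  have hset : {ω : Fin N → Fin B → X | t ≤ ∑ i, ∑ j, φ i (ω i j)}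
      = {ω | ENNReal.ofReal (Real.exp t)
          ≤ ENNReal.ofReal (Real.exp (∑ i, ∑ j, φ i (ω i j)))} := by
    ext ω
    simp [ENNReal.ofReal_le_ofReal_iff (Real.exp_pos _).le]
  rw [hset]
  refine (meas_ge_le_lintegral_div (Real.measurable_exp.comp hm).ennreal_ofReal.aemeasurable
    (by simp [Real.exp_pos]) ENNReal.ofReal_ne_top).trans ?_
  rw [Real.exp_sub, ENNReal.ofReal_div_of_pos (Real.exp_pos _)]
  gcongr
  exact hint

/-- From `exp t ≤ 1 + t + t²` for `|t| ≤ 1` and `f² ≤ f`. The quadratic term is thereby charged to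
the mean of `f` rather than to its range, which is what makes the tail below of Bernstein type. -/
theorem lintegral_exp_le_of_mem_Icc_zero {X : Type*} [MeasurableSpace X] (μ : Measure X)
    [IsProbabilityMeasure μ] (f : X → ℝ) (hf : Measurable f)
    (h : ∀ᵐ x ∂μ, 0 ≤ f x ∧ f x ≤ 1) (η : ℝ) (hη : |η| ≤ 1) :
    ∫⁻ x, ENNReal.ofReal (Real.exp (η * f x)) ∂μ
      ≤ ENNReal.ofReal (Real.exp ((η + η ^ 2) * ∫ x, f x ∂μ)) := by
  have hfi : Integrable f μ := by
    refine Integrable.of_bound hf.aestronglyMeasurable 1 ?_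
    filter_upwards [h] with x hx
    rw [Real.norm_of_nonneg hx.1]; exact hx.2
  have hpt : ∀ᵐ x ∂μ, Real.exp (η * f x) ≤ 1 + (η + η ^ 2) * f x := by
    filter_upwards [h] with x hx
    have h1 : |η * f x| ≤ 1 := by
      rw [abs_mul, abs_of_nonneg hx.1]
      nlinarith [abs_nonneg η]
    have h2 := Real.abs_exp_sub_one_sub_id_le h1
    have h3 := (abs_le.mp h2).2
    have h4 : (η * f x) ^ 2 ≤ η ^ 2 * f x := by
      rw [mul_pow]
      exact mul_le_mul_of_nonneg_left (by nlinarith [hx.1, hx.2]) (sq_nonneg _)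
    nlinarith
  have hint : Integrable (fun x => 1 + (η + η ^ 2) * f x) μ :=
    (integrable_const _).add (hfi.const_mul _)
  calc _ ≤ ∫⁻ x, ENNReal.ofReal (1 + (η + η ^ 2) * f x) ∂μ := by
        refine lintegral_mono_ae ?_
        filter_upwards [hpt] with x hx
        exact ENNReal.ofReal_le_ofReal hx
    _ = ENNReal.ofReal (∫ x, (1 + (η + η ^ 2) * f x) ∂μ) := by
        rw [ofReal_integral_eq_lintegral_ofReal hint]
        filter_upwards [hpt] with x hx
        exact (Real.exp_pos _).le.trans hx
    _ ≤ _ := by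
        refine ENNReal.ofReal_le_ofReal ?_
        rw [integral_add (integrable_const _) (hfi.const_mul _), integral_const_mul]
        simp only [integral_const, probReal_univ, smul_eq_mul, mul_one]
        rw [add_comm]
        exact Real.add_one_le_exp _

/-- Hoeffding's lemma on the interval `[-M, M]`. -/
theorem lintegral_exp_le_of_abs_le {X : Type*} [MeasurableSpace X] (μ : Measure X)
    [IsProbabilityMeasure μ] (f : X → ℝ) (hf : Measurable f) (M : ℝ)
    (h : ∀ᵐ x ∂μ, |f x| ≤ M) (h0 : ∫ x, f x ∂μ = 0) (t : ℝ) :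
    ∫⁻ x, ENNReal.ofReal (Real.exp (t * f x)) ∂μ
      ≤ ENNReal.ofReal (Real.exp (t ^ 2 * M ^ 2 / 2)) := by
  have hs := hasSubgaussianMGF_of_mem_Icc_of_integral_eq_zero (μ := μ) (X := f) (a := -M) (b := M)
    hf.aemeasurable (by filter_upwards [h] with x hx; exact abs_le.mp hx) h0
  have h1 := hs.mgf_le t
  rw [← ofReal_integral_eq_lintegral_ofReal (hs.integrable_exp_mul t)
    (Filter.Eventually.of_forall fun x => (Real.exp_pos _).le)]
  refine ENNReal.ofReal_le_ofReal (h1.trans (Real.exp_le_exp.mpr (le_of_eq ?_)))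
  simp only [NNReal.coe_pow, NNReal.coe_div, coe_nnnorm, NNReal.coe_ofNat, Real.norm_eq_abs,
    div_pow, sq_abs]
  ring

/-- Bernstein's bound for the sample mean of one group of observations. -/
theorem measure_abs_mean_sub_ge_le {N B : ℕ} {X : Type*} [MeasurableSpace X]
    (μ : Fin N → Measure X) [∀ i, IsProbabilityMeasure (μ i)] (i : Fin N) (hB : 0 < B)
    (f : X → ℝ) (hf : Measurable f) (M L ε : ℝ) (hM : 0 < M) (hL : 0 < L) (hε : 0 < ε)
    (hεL : ε ≤ 2 * L) (h : ∀ᵐ x ∂(μ i), 0 ≤ f x ∧ f x ≤ M) (hmean : ∫ x, f x ∂(μ i) ≤ L) :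
    Measure.pi (fun i => Measure.pi (fun _ : Fin B => μ i))
      {ω | ε ≤ |1 / (B : ℝ) * ∑ j, f (ω i j) - ∫ x, f x ∂(μ i)|}
      ≤ ENNReal.ofReal (2 * Real.exp (-(B * ε ^ 2 / (4 * L * M)))) := by
  have hBr : (0 : ℝ) < B := by exact_mod_cast hB
  set m := ∫ x, f x ∂(μ i) with hm
  -- The size `ε / (2L)` minimises `η² L - |η| ε`, with value `-ε² / (4L)`; the two signs of `η`
  -- give the two tails. The bound `ε ≤ 2L` is what makes `|η| ≤ 1`. The test on `k = i` selects one
  -- group inside the full product law.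
  have tail : ∀ η : ℝ, |η| = ε / (2 * L) →
      Measure.pi (fun i => Measure.pi (fun _ : Fin B => μ i))
        {ω | B * (η * m + |η| * ε) / M ≤ ∑ k, ∑ j, if k = i then η * (f (ω k j) / M) else 0}
        ≤ ENNReal.ofReal (Real.exp (-(B * ε ^ 2 / (4 * L * M)))) := by
    intro η hη
    have hη1 : |η| ≤ 1 := by rw [hη, div_le_one (by positivity)]; exact hεL
    refine (measure_pi_pi_sum_ge_le μ (fun k x => if k = i then η * (f x / M) else 0) ?_
      (fun k => if k = i then (η + η ^ 2) * (m / M) else 0) ?_ _).trans ?_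
    · intro k
      split_ifs
      · exact (hf.div_const _).const_mul _
      · exact measurable_const
    · intro k
      by_cases hk : k = i
      · subst hk
        simp only [if_true]
        rw [hm, ← integral_div]
        refine lintegral_exp_le_of_mem_Icc_zero (μ k) (fun x => f x / M) (hf.div_const _) ?_ η hη1
        filter_upwards [h] with x hx
        exact ⟨div_nonneg hx.1 hM.le, (div_le_one hM).mpr hx.2⟩
      · simp [hk]
    · refine ENNReal.ofReal_le_ofReal (Real.exp_le_exp.mpr ?_)
      simp only [Finset.sum_ite_eq', Finset.mem_univ, if_true]
      have e1 : (B : ℝ) * ((η + η ^ 2) * (m / M)) - B * (η * m + |η| * ε) / M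
          = B / M * (|η| ^ 2 * m - |η| * ε) := by
        rw [sq_abs]; ring
      have e2 : -((B : ℝ) * ε ^ 2 / (4 * L * M)) = B / M * (|η| ^ 2 * L - |η| * ε) := by
        rw [hη]; field_simp; ring
      rw [e1, e2]
      gcongr
  have hη0 : (0 : ℝ) < ε / (2 * L) := by positivity
  have t1 := tail (ε / (2 * L)) (abs_of_pos hη0)
  have t2 := tail (-(ε / (2 * L))) (by rw [abs_neg, abs_of_pos hη0])
  rw [two_mul, ENNReal.ofReal_add (Real.exp_pos _).le (Real.exp_pos _).le]
  refine (measure_mono ?_).trans ((measure_union_le _ _).trans (add_le_add t1 t2))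
  intro ω hω
  have hsum : ∀ η : ℝ, (∑ k, ∑ j, if k = i then η * (f (ω k j) / M) else 0)
      = η * (B / M) * (1 / (B : ℝ) * ∑ j, f (ω i j)) := by
    intro η
    rw [Finset.sum_eq_single i (fun k _ hk => by simp [hk]) (by simp)]
    simp only [if_true]
    rw [← Finset.mul_sum, ← Finset.sum_div]
    field_simp
  simp only [Set.mem_ofPred_eq] at hω
  simp only [Set.mem_union, Set.mem_ofPred_eq, hsum, abs_neg, abs_of_pos hη0]
  generalize ε / (2 * L) = η at *
  have hc : 0 < η * (B / M) := by positivity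
  rcases le_abs.mp hω with h1 | h1
  · left
    calc (B : ℝ) * (η * m + η * ε) / M = η * (B / M) * (m + ε) := by ring
      _ ≤ _ := by gcongr; linarith
  · right
    calc (B : ℝ) * (-η * m + η * ε) / M = η * (B / M) * (ε - m) := by ring
      _ ≤ η * (B / M) * (-(1 / (B : ℝ) * ∑ j, f (ω i j))) := by gcongr; linarith
      _ = _ := by ring

/-- Hoeffding's bound for the mean over all groups of observations. -/
theorem measure_abs_sum_ge_le {N B : ℕ} {X : Type*} [MeasurableSpace X]
    (μ : Fin N → Measure X) [∀ i, IsProbabilityMeasure (μ i)] (hN : 0 < N) (hB : 0 < B)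
    (f : X → ℝ) (hf : Measurable f) (M ε : ℝ) (hM : 0 < M) (hε : 0 < ε)
    (h : ∀ i, ∀ᵐ x ∂(μ i), |f x| ≤ M) (h0 : ∀ i, ∫ x, f x ∂(μ i) = 0) :
    Measure.pi (fun i => Measure.pi (fun _ : Fin B => μ i))
      {ω | ε * (N * B) ≤ |∑ i, ∑ j, f (ω i j)|}
      ≤ ENNReal.ofReal (2 * Real.exp (-(N * B * ε ^ 2 / (2 * M ^ 2)))) := by
  have hBr : (0 : ℝ) < B := by exact_mod_cast hB
  have hNr : (0 : ℝ) < N := by exact_mod_cast hN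
  -- The size `ε / M²` minimises `t² M² / 2 - |t| ε`, with value `-ε² / (2M²)`.
  have tail : ∀ t : ℝ, |t| = ε / M ^ 2 →
      Measure.pi (fun i => Measure.pi (fun _ : Fin B => μ i))
        {ω | |t| * (ε * (N * B)) ≤ ∑ k, ∑ j, t * f (ω k j)}
        ≤ ENNReal.ofReal (Real.exp (-(N * B * ε ^ 2 / (2 * M ^ 2)))) := by
    intro t ht
    refine (measure_pi_pi_sum_ge_le μ (fun _ x => t * f x) (fun _ => hf.const_mul _)
      (fun _ => t ^ 2 * M ^ 2 / 2)
      (fun i => lintegral_exp_le_of_abs_le (μ i) f hf M (h i) (h0 i) t) _).trans ?_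
    refine ENNReal.ofReal_le_ofReal (Real.exp_le_exp.mpr (le_of_eq ?_))
    rw [← sq_abs t, ht]
    simp only [Finset.sum_const, Finset.card_univ, Fintype.card_fin, nsmul_eq_mul]
    field_simp
    ring
  have ht0 : (0 : ℝ) < ε / M ^ 2 := by positivity
  have t1 := tail (ε / M ^ 2) (abs_of_pos ht0)
  have t2 := tail (-(ε / M ^ 2)) (by rw [abs_neg, abs_of_pos ht0])
  rw [two_mul, ENNReal.ofReal_add (Real.exp_pos _).le (Real.exp_pos _).le]
  refine (measure_mono ?_).trans ((measure_union_le _ _).trans (add_le_add t1 t2))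
  intro ω hω
  simp only [Set.mem_ofPred_eq] at hω
  simp only [Set.mem_union, Set.mem_ofPred_eq, ← Finset.mul_sum, abs_neg, abs_of_pos ht0]
  rcases le_abs.mp hω with h1 | h1
  · left; gcongr
  · right
    rw [neg_mul, ← mul_neg]
    gcongr

/-! ### Nets and quadratic forms on sparse vectors -/

/-- A 1-separated subset of the ball of largest cardinality is a 1-net, since an uncovered point
could be added to it. Separated sets have at most `5 ^ dim` points by volume comparison. -/
theorem exists_finset_cover_ball_two (E : Type*) [NormedAddCommGroup E] [NormedSpace ℝ E]
    [FiniteDimensional ℝ E] :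
    ∃ A : Finset E, A.card ≤ 5 ^ Module.finrank ℝ E ∧ (∀ a ∈ A, ‖a‖ ≤ 2) ∧
      ∀ x : E, ‖x‖ ≤ 2 → ∃ a ∈ A, ‖x - a‖ ≤ 1 := by
  classical
  let P : ℕ → Prop := fun n => ∃ A : Finset E, A.card = n ∧ (∀ a ∈ A, ‖a‖ ≤ 2) ∧
    ∀ a ∈ A, ∀ b ∈ A, a ≠ b → 1 ≤ ‖a - b‖
  have hbd : ∀ n, P n → n ≤ 5 ^ Module.finrank ℝ E := by
    rintro n ⟨A, rfl, h1, h2⟩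
    exact Besicovitch.card_le_of_separated A h1 h2
  have h0 : P 0 := ⟨∅, by simp⟩
  obtain ⟨A, hA, h1, h2⟩ := Nat.findGreatest_spec (P := P) (Nat.zero_le _) h0
  refine ⟨A, hA ▸ Nat.findGreatest_le _, h1, fun x hx => ?_⟩
  by_contra! hcon
  have hxA : x ∉ A := fun h => by simpa using (hcon x h).trans' zero_lt_one
  have hP : P (A.card + 1) := by
    refine ⟨insert x A, Finset.card_insert_of_notMem hxA, ?_, ?_⟩
    · intro a ha
      rcases Finset.mem_insert.mp ha with rfl | ha
      · exact hx
      · exact h1 a ha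
    · intro a ha b hb hab
      rcases Finset.mem_insert.mp ha with ha' | ha' <;>
        rcases Finset.mem_insert.mp hb with hb' | hb'
      · exact absurd (ha'.trans hb'.symm) hab
      · rw [ha']; exact (hcon b hb').le
      · rw [hb', norm_sub_rev]; exact (hcon a ha').le
      · exact h2 a ha' b hb' hab
  have := Nat.le_findGreatest (hbd _ hP) hP
  omega

/-- The previous net is used at two scales: `2x` is approximated to within 1, and twice the
remainder is approximated again. This squares the cardinality and brings the radius down to `1/4`.
-/
theorem exists_finset_cover_ball_one (E : Type*) [NormedAddCommGroup E] [NormedSpace ℝ E]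
    [FiniteDimensional ℝ E] :
    ∃ A : Finset E, A.card ≤ 25 ^ Module.finrank ℝ E ∧ (∀ a ∈ A, ‖a‖ ≤ 2) ∧
      ∀ x : E, ‖x‖ ≤ 1 → ∃ a ∈ A, ‖x - a‖ ≤ 1 / 4 := by
  classical
  obtain ⟨A, hA, h1, h2⟩ := exists_finset_cover_ball_two E
  refine ⟨(A ×ˢ A).image (fun p => (1 / 2 : ℝ) • p.1 + (1 / 4 : ℝ) • p.2), ?_, ?_, ?_⟩
  · refine Finset.card_image_le.trans ?_
    rw [Finset.card_product]
    calc A.card * A.card ≤ 5 ^ Module.finrank ℝ E * 5 ^ Module.finrank ℝ E :=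
          Nat.mul_le_mul hA hA
      _ = 25 ^ Module.finrank ℝ E := by rw [← mul_pow]; norm_num
  · intro a ha
    obtain ⟨p, hp, rfl⟩ := Finset.mem_image.mp ha
    have hp' := Finset.mem_product.mp hp
    refine (norm_add_le _ _).trans ?_
    rw [norm_smul, norm_smul, Real.norm_of_nonneg (by norm_num), Real.norm_of_nonneg (by norm_num)]
    linarith [h1 _ hp'.1, h1 _ hp'.2]
  · intro x hx
    obtain ⟨a, ha, hxa⟩ := h2 ((2 : ℝ) • x) (by
      rw [norm_smul, Real.norm_of_nonneg (by norm_num)]; linarith)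
    obtain ⟨a', ha', hxa'⟩ := h2 ((2 : ℝ) • ((2 : ℝ) • x - a)) (by
      rw [norm_smul, Real.norm_of_nonneg (by norm_num)]; linarith)
    refine ⟨(1 / 2 : ℝ) • a + (1 / 4 : ℝ) • a', Finset.mem_image.mpr ⟨(a, a'), ?_, rfl⟩, ?_⟩
    · exact Finset.mem_product.mpr ⟨ha, ha'⟩
    · have : x - ((1 / 2 : ℝ) • a + (1 / 4 : ℝ) • a')
          = (1 / 4 : ℝ) • ((2 : ℝ) • ((2 : ℝ) • x - a) - a') := by module
      rw [this, norm_smul, Real.norm_of_nonneg (by norm_num)]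
      linarith

/-- Let `m` be the maximum of `|M v v|` on the unit ball, attained at `v₀`, and let `a` be a net
point near `v₀`. Then `M v₀ v₀ - M a a = M (v₀ + a) (v₀ - a)`, and polarisation bounds this by `9/16
* m`. Hence `m ≤ ε + 9/16 * m`, so `m ≤ 16/7 * ε ≤ 3ε`. -/
theorem abs_bilin_self_le_of_net {V : Type*} [NormedAddCommGroup V] [InnerProductSpace ℝ V]
    [FiniteDimensional ℝ V] (M : V →ₗ[ℝ] V →ₗ[ℝ] ℝ) (hM : ∀ u v, M u v = M v u)
    (A : Finset V) (hA : ∀ x : V, ‖x‖ ≤ 1 → ∃ a ∈ A, ‖x - a‖ ≤ 1 / 4) (ε : ℝ)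
    (h : ∀ a ∈ A, |M a a| ≤ ε) (v : V) : |M v v| ≤ 3 * ε * ‖v‖ ^ 2 := by
  have hcont : Continuous (fun v => |M v v|) := by
    have h1 : Continuous (fun v => M.toContinuousBilinearMap v v) :=
      M.toContinuousBilinearMap.continuous.clm_apply continuous_id
    exact h1.abs
  obtain ⟨v₀, hv₀, hmax⟩ := (isCompact_closedBall (0 : V) 1).exists_isMaxOn
    ⟨0, by simp⟩ hcont.continuousOn
  have hv₀' : ‖v₀‖ ≤ 1 := by simpa using hv₀
  set m := |M v₀ v₀| with hm
  have hm0 : 0 ≤ m := abs_nonneg _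
  have hall : ∀ w : V, |M w w| ≤ m * ‖w‖ ^ 2 := by
    intro w
    by_cases hw : w = 0
    · simp [hw]
    have hwn : ‖w‖ ≠ 0 := norm_ne_zero_iff.mpr hw
    have h1 : |M (‖w‖⁻¹ • w) (‖w‖⁻¹ • w)| ≤ m :=
      hmax (by simp [norm_smul, hwn])
    simp only [map_smul, LinearMap.smul_apply, smul_eq_mul, abs_mul, abs_inv, abs_norm] at h1
    calc |M w w| = ‖w‖⁻¹ * (‖w‖⁻¹ * |M w w|) * ‖w‖ ^ 2 := by field_simp
      _ ≤ _ := by gcongr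
  obtain ⟨a, ha, hva⟩ := hA v₀ hv₀'
  set r := v₀ - a with hr
  set p := v₀ + a with hp
  have hpn : ‖p‖ ≤ 9 / 4 := by
    have : p = (2 : ℝ) • v₀ - r := by rw [hp, hr]; module
    rw [this]
    refine (norm_sub_le _ _).trans ?_
    rw [norm_smul, Real.norm_of_nonneg (by norm_num)]
    linarith
  have hdiff : M v₀ v₀ - M a a = M p r := by
    rw [hp, hr]
    simp only [map_add, map_sub, LinearMap.add_apply]
    rw [hM v₀ a]; ring
  -- The weights `1/3` and `3` balance the two vectors: `‖p‖ ≤ 9/4` and `‖r‖ ≤ 1/4` both become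
  -- `3/4`.
  have hpol : 4 * M p r = M ((1 / 3 : ℝ) • p + (3 : ℝ) • r) ((1 / 3 : ℝ) • p + (3 : ℝ) • r)
      - M ((1 / 3 : ℝ) • p - (3 : ℝ) • r) ((1 / 3 : ℝ) • p - (3 : ℝ) • r) := by
    simp only [map_add, map_sub, LinearMap.add_apply, LinearMap.sub_apply, map_smul,
      LinearMap.smul_apply, smul_eq_mul]
    rw [hM r p]; ring
  have hnorm := parallelogram_law_with_norm ℝ ((1 / 3 : ℝ) • p) ((3 : ℝ) • r)
  rw [norm_smul, norm_smul, Real.norm_of_nonneg (by norm_num : (0 : ℝ) ≤ 1 / 3),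
    Real.norm_of_nonneg (by norm_num : (0 : ℝ) ≤ 3)] at hnorm
  have hpr : |M p r| ≤ 9 / 16 * m := by
    have h1 := hall ((1 / 3 : ℝ) • p + (3 : ℝ) • r)
    have h2 := hall ((1 / 3 : ℝ) • p - (3 : ℝ) • r)
    have h3 : 4 * |M p r| ≤ m * ‖(1 / 3 : ℝ) • p + (3 : ℝ) • r‖ ^ 2
        + m * ‖(1 / 3 : ℝ) • p - (3 : ℝ) • r‖ ^ 2 := by
      calc 4 * |M p r| = |4 * M p r| := by rw [abs_mul]; norm_num
        _ ≤ _ := by rw [hpol]; exact (abs_sub _ _).trans (add_le_add h1 h2)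
    have h4 : ‖p‖ * ‖p‖ ≤ 81 / 16 := by nlinarith [norm_nonneg p]
    have h5 : ‖r‖ * ‖r‖ ≤ 1 / 16 := by nlinarith [norm_nonneg r]
    have h6 : ‖(1 / 3 : ℝ) • p + (3 : ℝ) • r‖ ^ 2 + ‖(1 / 3 : ℝ) • p - (3 : ℝ) • r‖ ^ 2
        ≤ 9 / 4 := by nlinarith
    nlinarith
  have hm3 : m ≤ 3 * ε := by
    have h1 : m ≤ ε + 9 / 16 * m := by
      calc m = |M a a + M p r| := by rw [hm, ← hdiff]; ring_nf
        _ ≤ _ := (abs_add_le _ _).trans (add_le_add (h a ha) hpr)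
    linarith [(abs_nonneg _).trans (h a ha)]
  exact (hall v).trans (by gcongr)

/-- A finite set of vectors that controls every symmetric bilinear form on `s`-sparse vectors. -/
theorem exists_finset_control_sparse (d s : ℕ) (hs : 0 < s) :
    ∃ A : Finset (Vec d), A.card ≤ d ^ s * 25 ^ s ∧ (∀ a ∈ A, ‖a‖ ≤ 2) ∧
      (∀ a ∈ A, l0 a ≤ s) ∧
      ∀ M : Vec d →ₗ[ℝ] Vec d →ₗ[ℝ] ℝ, (∀ u v, M u v = M v u) → ∀ ε, (∀ a ∈ A, |M a a| ≤ ε) →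
        ∀ v, l0 v ≤ s → |M v v| ≤ 3 * ε * ‖v‖ ^ 2 := by
  classical
  -- Coordinate subspaces are indexed by maps rather than by `s`-element subsets: the count is at
  -- most `d ^ s`, and repeated values accommodate smaller supports, also when `s > d`.
  let E : (Fin s → Fin d) → Submodule ℝ (Vec d) := fun f =>
    Submodule.span ℝ (Set.range (fun k => EuclideanSpace.single (f k) (1 : ℝ)))
  have hdim : ∀ f, Module.finrank ℝ (E f) ≤ s := fun f => by
    have h := finrank_range_le_card (R := ℝ) (fun k => EuclideanSpace.single (f k) (1 : ℝ))
    rwa [Fintype.card_fin] at h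
  have hsupp : ∀ f, ∀ v ∈ E f, l0 v ≤ s := by
    intro f v hv
    have hz : ∀ l, l ∉ Finset.univ.image f → v l = 0 := by
      intro l hl
      induction hv using Submodule.span_induction with
      | mem x hx =>
        obtain ⟨k, rfl⟩ := hx
        have : l ≠ f k := fun h => hl (by simp [h])
        simp [this]
      | zero => simp
      | add x y _ _ hx hy => simp [hx, hy]
      | smul c x _ hx => simp [hx]
    calc l0 v ≤ (Finset.univ.image f).card := by
          refine Finset.card_le_card (fun l hl => ?_)
          by_contra hcon
          exact (Finset.mem_filter.mp hl).2 (hz l hcon)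
      _ ≤ s := Finset.card_image_le.trans (by simp)
  choose A hA1 hA2 hA3 using fun f => exists_finset_cover_ball_one (E f)
  refine ⟨Finset.univ.biUnion (fun f => (A f).image (E f).subtype), ?_, ?_, ?_, ?_⟩
  · refine (Finset.card_biUnion_le_card_mul _ _ (25 ^ s) (fun f _ => ?_)).trans ?_
    · exact Finset.card_image_le.trans ((hA1 f).trans (Nat.pow_le_pow_right (by norm_num) (hdim f)))
    · simp
  · intro a ha
    obtain ⟨f, -, hf⟩ := Finset.mem_biUnion.mp ha
    obtain ⟨a', ha', rfl⟩ := Finset.mem_image.mp hf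
    exact hA2 f a' ha'
  · intro a ha
    obtain ⟨f, -, hf⟩ := Finset.mem_biUnion.mp ha
    obtain ⟨a', ha', rfl⟩ := Finset.mem_image.mp hf
    exact hsupp f a' a'.2
  · intro M hM ε hε v hv
    by_cases hv0 : v = 0
    · simp [hv0]
    obtain ⟨l₀, hl₀⟩ : ∃ l, v l ≠ 0 := by
      by_contra! hcon
      exact hv0 (by ext l; simpa using hcon l)
    have : Nonempty (Fin s) := ⟨⟨0, hs⟩⟩
    set S := Finset.univ.filter (fun l : Fin d => v l ≠ 0) with hS
    have hSc : Fintype.card S ≤ Fintype.card (Fin s) := by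
      rw [Fintype.card_coe, Fintype.card_fin]; exact hv
    obtain ⟨g⟩ := Function.Embedding.nonempty_of_card_le hSc
    -- The map enumerates the support of `v`; slots that are not needed repeat the support index
    -- `l₀`.
    let f : Fin s → Fin d := fun k => if h : ∃ l : S, g l = k then (h.choose : Fin d) else l₀
    have hf : ∀ l, v l ≠ 0 → ∃ k, f k = l := by
      intro l hl
      let l' : S := ⟨l, by simp [hS, hl]⟩
      have hex : ∃ l'' : S, g l'' = g l' := ⟨l', rfl⟩
      refine ⟨g l', ?_⟩
      simp only [f, dif_pos hex]
      rw [g.injective hex.choose_spec]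
    have hvE : v ∈ E f := by
      have hv' : v = ∑ l, v l • EuclideanSpace.single l (1 : ℝ) := by
        ext l
        simp [Finset.sum_apply, Pi.single_apply]
      rw [hv']
      refine Submodule.sum_mem _ (fun l _ => ?_)
      by_cases hl : v l = 0
      · simp [hl]
      · obtain ⟨k, hk⟩ := hf l hl
        refine Submodule.smul_mem _ _ (Submodule.subset_span ⟨k, ?_⟩)
        simp [hk]
    have := abs_bilin_self_le_of_net (V := E f)
      ((M.comp (E f).subtype).compl₂ (E f).subtype) (fun u w => by simp [hM]) (A f) (hA3 f) ε
      (fun a ha => by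
        simpa using hε a (Finset.mem_biUnion.mpr ⟨f, Finset.mem_univ _,
          Finset.mem_image.mpr ⟨a, ha, rfl⟩⟩)) ⟨v, hvE⟩
    simpa using this

/-! ### Hard thresholding -/

theorem norm_sq_eq_sum {d : ℕ} (x : Vec d) : ‖x‖ ^ 2 = ∑ l, x l ^ 2 := by
  rw [EuclideanSpace.norm_sq_eq]
  simp

/-- The indices of the nonzero entries. -/
noncomputable def supp {d : ℕ} (x : Vec d) : Finset (Fin d) :=
  Finset.univ.filter (fun l => x l ≠ 0)

theorem card_supp {d : ℕ} (x : Vec d) : (supp x).card = l0 x := rfl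

theorem mem_supp {d : ℕ} {x : Vec d} {l : Fin d} : l ∈ supp x ↔ x l ≠ 0 := by simp [supp]

theorem l0_le_card {d : ℕ} {x : Vec d} {I : Finset (Fin d)} (h : ∀ l, l ∉ I → x l = 0) :
    l0 x ≤ I.card := by
  rw [← card_supp]
  refine Finset.card_le_card (fun l hl => ?_)
  by_contra hcon
  exact mem_supp.mp hl (h l hcon)

/-- The number of entries that hard thresholding ranks before the entry `l`. -/
noncomputable def entryRank {d : ℕ} (x : Vec d) (l : Fin d) : ℕ :=
  (Finset.univ.filter (fun m : Fin d => |x l| < |x m| ∨ (|x m| = |x l| ∧ m < l))).card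

theorem hardThreshold_apply {d : ℕ} (τ : ℕ) (x : Vec d) (l : Fin d) :
    hardThreshold τ x l = if entryRank x l < τ then x l else 0 := rfl

theorem entryRank_lt_entryRank {d : ℕ} (x : Vec d) {m l : Fin d}
    (h : |x l| < |x m| ∨ (|x m| = |x l| ∧ m < l)) : entryRank x m < entryRank x l := by
  refine Finset.card_lt_card (Finset.ssubset_iff_of_subset ?_ |>.mpr ⟨m, ?_, ?_⟩)
  · intro k hk
    simp only [Finset.mem_filter, Finset.mem_univ, true_and] at hk ⊢
    rcases h with h | ⟨h, h'⟩ <;> rcases hk with hk | ⟨hk, hk'⟩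
    · exact Or.inl (h.trans hk)
    · exact Or.inl (hk ▸ h)
    · exact Or.inl (h ▸ hk)
    · exact Or.inr ⟨hk.trans h, hk'.trans h'⟩
  · simpa using h
  · simp

/-- Breaking ties by index makes the ranking a strict total order. Ranks are therefore a bijection
onto `0, …, d - 1`, and exactly `τ` entries are kept when `τ ≤ d`. -/
theorem entryRank_injective {d : ℕ} (x : Vec d) : Function.Injective (entryRank x) := by
  intro l m h
  by_contra hne
  rcases lt_trichotomy |x l| |x m| with h1 | h1 | h1
  · exact (entryRank_lt_entryRank x (Or.inl h1)).ne' h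
  · rcases lt_or_gt_of_ne hne with h2 | h2
    · exact (entryRank_lt_entryRank x (Or.inr ⟨h1, h2⟩)).ne h
    · exact (entryRank_lt_entryRank x (Or.inr ⟨h1.symm, h2⟩)).ne' h
  · exact (entryRank_lt_entryRank x (Or.inl h1)).ne h

theorem entryRank_lt {d : ℕ} (x : Vec d) (l : Fin d) : entryRank x l < d := by
  have : entryRank x l < (Finset.univ : Finset (Fin d)).card := by
    refine Finset.card_lt_card (Finset.ssubset_univ_iff.mpr (fun h => ?_))
    have := h ▸ Finset.mem_univ l
    simp at this
  simpa using this

theorem card_entryRank_lt {d : ℕ} (x : Vec d) {τ : ℕ} (hτ : τ ≤ d) :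
    (Finset.univ.filter (fun l => entryRank x l < τ)).card = τ := by
  let r : Fin d → Fin d := fun l => ⟨entryRank x l, entryRank_lt x l⟩
  have hr : Function.Bijective r := Finite.injective_iff_bijective.mp (fun a b h =>
    entryRank_injective x (by simpa [r] using h))
  have hcard := Finset.card_bijective (s := Finset.univ.filter (fun l => entryRank x l < τ))
    (t := Finset.univ.filter (fun k : Fin d => (k : ℕ) < τ)) r hr (by simp [r])
  rw [hcard, Fin.card_filter_val_lt, min_eq_right hτ]

theorem l0_hardThreshold_le {d : ℕ} (τ : ℕ) (x : Vec d) : l0 (hardThreshold τ x) ≤ τ := by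
  rcases le_total τ d with h | h
  · refine (l0_le_card (I := Finset.univ.filter (fun l => entryRank x l < τ)) ?_).trans
      (card_entryRank_lt x h).le
    intro l hl
    rw [hardThreshold_apply, if_neg (by simpa using hl)]
  · exact (l0_le_card (I := Finset.univ) (by simp)).trans (by simpa using h)

theorem proj_apply {d : ℕ} (I : Finset (Fin d)) (x : Vec d) (l : Fin d) :
    proj I x l = if l ∈ I then x l else 0 := rfl

/-- Hard thresholding is nearly nonexpansive towards a much sparser vector. -/
theorem norm_hardThreshold_sub_sq_le {d : ℕ} {τ : ℕ} (u xs : Vec d) (hτ : l0 xs < τ)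
    (I : Finset (Fin d)) (hI : supp (hardThreshold τ u) ⊆ I) (hI' : supp xs ⊆ I) :
    ‖hardThreshold τ u - xs‖ ^ 2
      ≤ (1 + 2 * √(l0 xs : ℝ) / √((τ : ℝ) - l0 xs)) * ‖proj I u - xs‖ ^ 2 := by
  set α := 2 * √(l0 xs : ℝ) / √((τ : ℝ) - l0 xs) with hα
  have hα0 : 0 ≤ α := by positivity
  set S := Finset.univ.filter (fun l => entryRank u l < τ) with hS
  set A := supp xs \ S with hA
  set D := S \ supp xs with hD
  have memS : ∀ l, l ∈ S ↔ entryRank u l < τ := by simp [hS]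
  have hHS : ∀ l ∈ S, hardThreshold τ u l = u l := fun l hl => by
    rw [hardThreshold_apply, if_pos ((memS l).mp hl)]
  have hHS' : ∀ l ∉ S, hardThreshold τ u l = 0 := fun l hl => by
    rw [hardThreshold_apply, if_neg (fun h => hl ((memS l).mpr h))]
  have hleft : ‖hardThreshold τ u - xs‖ ^ 2 = ∑ l ∈ S, (u l - xs l) ^ 2 + ∑ l ∈ A, xs l ^ 2 := by
    rw [norm_sq_eq_sum, ← Finset.sum_add_sum_compl S]
    congr 1
    · exact Finset.sum_congr rfl (fun l hl => by rw [PiLp.sub_apply, hHS l hl])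
    · symm
      refine Finset.sum_subset_zero_on_sdiff ?_ ?_ ?_
      · intro l hl
        exact Finset.mem_compl.mpr (Finset.mem_sdiff.mp hl).2
      · intro l hl
        have h1 := Finset.mem_sdiff.mp hl
        have h2 : l ∉ S := Finset.mem_compl.mp h1.1
        have h3 : xs l = 0 := by
          by_contra hne
          exact h1.2 (Finset.mem_sdiff.mpr ⟨mem_supp.mpr hne, h2⟩)
        rw [PiLp.sub_apply, hHS' l h2, h3]; simp
      · intro l hl
        rw [PiLp.sub_apply, hHS' l (Finset.mem_sdiff.mp hl).2]; simp
  have hright : ∑ l ∈ S, (u l - xs l) ^ 2 + ∑ l ∈ A, (u l - xs l) ^ 2 ≤ ‖proj I u - xs‖ ^ 2 := by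
    have hdis : Disjoint S A := Finset.disjoint_sdiff
    rw [norm_sq_eq_sum, ← Finset.sum_union hdis]
    calc _ = ∑ l ∈ S ∪ A, (proj I u - xs) l ^ 2 := by
          refine Finset.sum_congr rfl (fun l hl => ?_)
          rw [PiLp.sub_apply, proj_apply]
          split_ifs with h
          · rfl
          · have hlA : l ∉ A := fun h' => h (hI' (Finset.mem_sdiff.mp h').1)
            have hlS : l ∈ S := (Finset.mem_union.mp hl).resolve_right hlA
            have : u l = 0 := by
              by_contra hne
              exact h (hI (mem_supp.mpr (by rwa [hHS l hlS])))
            rw [this]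
      _ ≤ _ := Finset.sum_le_sum_of_subset_of_nonneg (Finset.subset_univ _)
          (fun _ _ _ => sq_nonneg _)
  have hP : ∑ l ∈ D, u l ^ 2 ≤ ∑ l ∈ S, (u l - xs l) ^ 2 := by
    calc ∑ l ∈ D, u l ^ 2 = ∑ l ∈ D, (u l - xs l) ^ 2 := by
          refine Finset.sum_congr rfl (fun l hl => ?_)
          have : xs l = 0 := by
            by_contra hne
            exact (Finset.mem_sdiff.mp hl).2 (mem_supp.mpr hne)
          rw [this, sub_zero]
      _ ≤ _ := Finset.sum_le_sum_of_subset_of_nonneg Finset.sdiff_subset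
          (fun _ _ _ => sq_nonneg _)
  set P := ∑ l ∈ D, u l ^ 2
  set R := ∑ l ∈ A, (u l - xs l) ^ 2
  set Q := ∑ l ∈ A, u l ^ 2 with hQ
  have hP0 : 0 ≤ P := Finset.sum_nonneg (fun _ _ => sq_nonneg _)
  have hR0 : 0 ≤ R := Finset.sum_nonneg (fun _ _ => sq_nonneg _)
  have hQ0 : 0 ≤ Q := Finset.sum_nonneg (fun _ _ => sq_nonneg _)
  -- `A` is the part of the support of `xs` that thresholding loses, `D` the kept indices outside
  -- that support. The lost mass `∑ xs²` over `A` has to be paid by `R`, the error on `A`, and `P`,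
  -- the error on `D`.
  suffices key : ∑ l ∈ A, xs l ^ 2 ≤ R + α * (P + R) by
    rw [hleft]
    nlinarith
  by_cases hA0 : A = ∅
  · simp only [hA0, Finset.sum_empty]
    positivity
  obtain ⟨l₀, hl₀⟩ := Finset.nonempty_iff_ne_empty.mpr hA0
  have hτd : τ ≤ d := by
    by_contra hcon
    have h1 := (Finset.mem_sdiff.mp hl₀).2
    exact h1 ((memS l₀).mpr ((entryRank_lt u l₀).trans (not_le.mp hcon)))
  have hScard : S.card = τ := card_entryRank_lt u hτd
  have hA1 : 0 < A.card := Finset.card_pos.mpr ⟨l₀, hl₀⟩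
  have hcA : A.card ≤ l0 xs := Finset.card_le_card Finset.sdiff_subset
  have hcD : (D.card : ℝ) = (τ : ℝ) - l0 xs + A.card := by
    have h1 := Finset.card_sdiff_add_card_inter S (supp xs)
    have h2 := Finset.card_sdiff_add_card_inter (supp xs) S
    rw [Finset.inter_comm] at h2
    rw [card_supp] at h2
    have h1' : (D.card : ℝ) + (S ∩ supp xs).card = τ := by rw [← hScard]; exact_mod_cast h1
    have h2' : (A.card : ℝ) + (S ∩ supp xs).card = l0 xs := by exact_mod_cast h2
    linarith
  -- Double counting over `A × D`: every discarded entry is at most as large as every kept one.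
  have hdbl : (D.card : ℝ) * Q ≤ A.card * P := by
    have h1 : ∑ l ∈ A, ∑ m ∈ D, u l ^ 2 ≤ ∑ l ∈ A, ∑ m ∈ D, u m ^ 2 := by
      refine Finset.sum_le_sum (fun l hl => Finset.sum_le_sum (fun m hm => ?_))
      have hl' : l ∉ S := (Finset.mem_sdiff.mp hl).2
      have hm' : m ∈ S := (Finset.mem_sdiff.mp hm).1
      refine sq_le_sq.mpr ?_
      by_contra hcon
      exact hl' ((memS l).mpr ((entryRank_lt_entryRank u (Or.inl (not_le.mp hcon))).trans
        ((memS m).mp hm')))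
    simpa [Finset.sum_const, ← Finset.mul_sum, hQ] using h1
  have hs0 : (0 : ℝ) < l0 xs := by exact_mod_cast hA1.trans_le hcA
  have hτ' : (l0 xs : ℝ) < τ := by exact_mod_cast hτ
  have hcA' : (A.card : ℝ) ≤ l0 xs := by exact_mod_cast hcA
  have hA1' : (0 : ℝ) < A.card := by exact_mod_cast hA1
  rw [hcD] at hdbl
  have hQP : Q ≤ P := by
    have : (A.card : ℝ) * Q ≤ A.card * P := by nlinarith
    exact le_of_mul_le_mul_left this hA1'
  -- Adding `(τ* - |A|) Q ≤ (τ* - |A|) P` to `hdbl`, in which `|D| = τ - τ* + |A|`.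
  have hτQ : (τ : ℝ) * Q ≤ l0 xs * P := by nlinarith
  -- The Young weight for `xs = u - (u - xs)`. As `Q ≤ β² P`, the term `(1 + 1/β) Q` costs only `(β²
  -- + β) P ≤ 2β P`, and `2β ≤ α`.
  set β := √((l0 xs : ℝ) / τ) with hβ
  have hτ0 : (0 : ℝ) < τ := hs0.trans hτ'
  have hβ0 : 0 < β := Real.sqrt_pos.mpr (by positivity)
  have hβsq : β ^ 2 = l0 xs / τ := Real.sq_sqrt (by positivity)
  have hβ1 : β ≤ 1 := by
    refine Real.sqrt_le_iff.mpr ⟨zero_le_one, ?_⟩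
    rw [one_pow, div_le_one hτ0]
    exact hτ'.le
  have hβα : 2 * β ≤ α := by
    rw [hα, hβ, Real.sqrt_div hs0.le, mul_div_assoc]
    have : 0 < √((τ : ℝ) - l0 xs) := Real.sqrt_pos.mpr (by linarith)
    gcongr
    linarith
  have hQβ : Q ≤ β ^ 2 * P := by
    rw [hβsq, div_mul_eq_mul_div, le_div_iff₀ hτ0]
    linarith
  have hsum : ∑ l ∈ A, xs l ^ 2 ≤ (1 + β⁻¹) * Q + (1 + β) * R := by
    rw [hQ, Finset.mul_sum, Finset.mul_sum, ← Finset.sum_add_distrib]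
    refine Finset.sum_le_sum (fun l _ => ?_)
    have h1 : (1 + β⁻¹) * u l ^ 2 + (1 + β) * (u l - xs l) ^ 2 - xs l ^ 2
        = β⁻¹ * (u l + β * (u l - xs l)) ^ 2 := by field_simp; ring
    have : 0 ≤ β⁻¹ * (u l + β * (u l - xs l)) ^ 2 := by positivity
    linarith
  have h2 : (1 + β⁻¹) * Q ≤ (1 + β⁻¹) * (β ^ 2 * P) := by gcongr
  have h3 : (1 + β⁻¹) * (β ^ 2 * P) = (β ^ 2 + β) * P := by field_simp
  nlinarith [mul_nonneg hβ0.le hP0, mul_nonneg hβ0.le hR0, mul_nonneg (sub_nonneg.mpr hβ1) hβ0.le]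

/-! ### Gradients of the logistic losses -/

theorem hasDerivAt_logisticProb (u : ℝ) : HasDerivAt logisticProb (logisticCurv u) u := by
  have h := (Real.hasDerivAt_exp u).div ((Real.hasDerivAt_exp u).const_add 1)
    (by positivity : 1 + Real.exp u ≠ 0)
  refine h.congr_deriv ?_
  unfold logisticCurv
  congr 1
  ring

/-- The gradient of the loss of one observation. -/
noncomputable def obsGrad {d : ℕ} (o : Vec d × ℝ) (x : Vec d) : Vec d :=
  (logisticProb (inner ℝ o.1 x) - o.2) • o.1

theorem hasGradientAt_obsLoss {d : ℕ} (o : Vec d × ℝ) (x : Vec d) :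
    HasGradientAt (obsLoss o) (obsGrad o x) x := by
  have hin : HasFDerivAt (fun x : Vec d => inner ℝ o.1 x) (innerSL ℝ o.1) x :=
    (innerSL ℝ o.1).hasFDerivAt
  have hs : HasDerivAt (fun u => Real.log (1 + Real.exp u) - o.2 * u)
      (logisticProb (inner ℝ o.1 x) - o.2) (inner ℝ o.1 x) := by
    have h1 := ((Real.hasDerivAt_exp (inner ℝ o.1 x)).const_add 1).log
      (by positivity : 1 + Real.exp (inner ℝ o.1 x) ≠ 0)
    have h2 := (hasDerivAt_id (inner ℝ o.1 x)).const_mul o.2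
    exact (h1.sub h2).congr_deriv (by simp [logisticProb])
  rw [hasGradientAt_iff_hasFDerivAt]
  refine (hs.comp_hasFDerivAt x hin).congr_fderiv ?_
  ext v
  simp [obsGrad]

theorem hasGradientAt_mean {d n : ℕ} (c : ℝ) (f : Fin n → Vec d → ℝ) (f' : Fin n → Vec d)
    (x : Vec d) (h : ∀ i, HasGradientAt (f i) (f' i) x) :
    HasGradientAt (fun x => c * ∑ i, f i x) (c • ∑ i, f' i) x := by
  rw [hasGradientAt_iff_hasFDerivAt]
  have h1 := (HasFDerivAt.fun_sum (u := Finset.univ)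
    (fun i _ => (hasGradientAt_iff_hasFDerivAt.mp (h i)))).const_mul c
  refine h1.congr_fderiv ?_
  simp

theorem gradient_batchLoss {d B m : ℕ} (data : Fin B → Vec d × ℝ) (I : Fin m → Fin B)
    (x : Vec d) :
    ∇ (batchLoss data I) x = (1 / (m : ℝ)) • ∑ r, obsGrad (data (I r)) x :=
  (hasGradientAt_mean _ _ _ x (fun r => hasGradientAt_obsLoss (data (I r)) x)).gradient

theorem hasGradientAt_clientLoss {d B : ℕ} (data : Fin B → Vec d × ℝ) (x : Vec d) :
    HasGradientAt (clientLoss data) ((1 / (B : ℝ)) • ∑ j, obsGrad (data j) x) x :=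
  hasGradientAt_mean _ _ _ x (fun j => hasGradientAt_obsLoss (data j) x)

theorem gradient_clientLoss {d B : ℕ} (data : Fin B → Vec d × ℝ) (x : Vec d) :
    ∇ (clientLoss data) x = (1 / (B : ℝ)) • ∑ j, obsGrad (data j) x :=
  (hasGradientAt_clientLoss data x).gradient

theorem gradient_globalLoss {d N B : ℕ} (data : Fin N → Fin B → Vec d × ℝ) (x : Vec d) :
    ∇ (globalLoss data) x
      = (1 / (N : ℝ)) • ∑ i, (1 / (B : ℝ)) • ∑ j, obsGrad (data i j) x :=
  (hasGradientAt_mean _ _ _ x (fun i => hasGradientAt_clientLoss (data i) x)).gradient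

theorem norm_obsGrad_le {d : ℕ} {o : Vec d × ℝ} {Kz : ℝ} (hz : ‖o.1‖ ≤ Kz)
    (hy : 0 ≤ o.2 ∧ o.2 ≤ 1) (x : Vec d) : ‖obsGrad o x‖ ≤ Kz := by
  have h0 := logisticProb_nonneg (inner ℝ o.1 x)
  have h1 := logisticProb_le_one (inner ℝ o.1 x)
  have h2 : |logisticProb (inner ℝ o.1 x) - o.2| ≤ 1 := by
    rw [abs_le]; constructor <;> linarith [hy.1, hy.2]
  rw [obsGrad, norm_smul, Real.norm_eq_abs]
  nlinarith [norm_nonneg o.1, abs_nonneg (logisticProb (inner ℝ o.1 x) - o.2)]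

/-- The mean value theorem along the segment, with `w` the curvature at an intermediate point.
Gradient differences become second moments with weights in `[Clow, Cup]`, so no Hessian is needed.
-/
theorem exists_logisticProb_sub_eq {d : ℕ} {Clow Cup : ℝ} (z xs y : Vec d)
    (h : ∀ x ∈ segment ℝ xs y, Clow ≤ logisticCurv (inner ℝ z x) ∧
      logisticCurv (inner ℝ z x) ≤ Cup) :
    ∃ w, Clow ≤ w ∧ w ≤ Cup ∧
      logisticProb (inner ℝ z y) - logisticProb (inner ℝ z xs) = w * inner ℝ z (y - xs) := by
  have hlin : ∀ t : ℝ, HasDerivAt (fun t : ℝ => inner ℝ z xs + t * inner ℝ z (y - xs))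
      (inner ℝ z (y - xs)) t := fun t => by
    simpa using ((hasDerivAt_id t).mul_const (inner ℝ z (y - xs))).const_add (inner ℝ z xs)
  have hder := fun t : ℝ => (hasDerivAt_logisticProb _).comp t (hlin t)
  obtain ⟨c, hc, hslope⟩ := exists_hasDerivAt_eq_slope _ _ zero_lt_one
    (continuous_iff_continuousAt.mpr (fun t => (hder t).continuousAt)).continuousOn
    (fun t _ => hder t)
  have hx : inner ℝ z (xs + c • (y - xs)) = inner ℝ z xs + c * inner ℝ z (y - xs) := by
    rw [inner_add_right, inner_smul_right]
  have hseg := h (xs + c • (y - xs)) (by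
    rw [segment_eq_image']
    exact ⟨c, ⟨hc.1.le, hc.2.le⟩, rfl⟩)
  rw [hx] at hseg
  refine ⟨_, hseg.1, hseg.2, ?_⟩
  rw [hslope]
  simp [inner_sub_right]

/-! ### Coordinate projections -/

theorem proj_sub {d : ℕ} (I : Finset (Fin d)) (x y : Vec d) :
    proj I (x - y) = proj I x - proj I y := by
  ext l; simp only [proj_apply, PiLp.sub_apply]; split_ifs <;> simp

theorem proj_smul {d : ℕ} (I : Finset (Fin d)) (c : ℝ) (x : Vec d) :
    proj I (c • x) = c • proj I x := by
  ext l; simp only [proj_apply, PiLp.smul_apply]; split_ifs <;> simp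

theorem proj_eq_self {d : ℕ} {I : Finset (Fin d)} {x : Vec d} (h : supp x ⊆ I) :
    proj I x = x := by
  ext l
  rw [proj_apply]
  split_ifs with hl
  · rfl
  · by_contra hne
    exact hl (h (mem_supp.mpr (Ne.symm hne)))

theorem inner_proj_left {d : ℕ} (I : Finset (Fin d)) (x y : Vec d) :
    inner ℝ (proj I x) y = inner ℝ x (proj I y) := by
  simp only [PiLp.inner_apply, proj_apply]
  refine Finset.sum_congr rfl (fun l _ => ?_)
  split_ifs <;> simp

theorem proj_proj {d : ℕ} (I : Finset (Fin d)) (x : Vec d) : proj I (proj I x) = proj I x := by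
  ext l; simp only [proj_apply]; split_ifs <;> simp

theorem norm_proj_sq {d : ℕ} (I : Finset (Fin d)) (x : Vec d) :
    ‖proj I x‖ ^ 2 = ∑ l ∈ I, x l ^ 2 := by
  rw [norm_sq_eq_sum]
  simp [proj_apply, ite_pow, Finset.sum_ite_mem]

theorem norm_proj_sq_le {d : ℕ} (I : Finset (Fin d)) (x : Vec d) : ‖proj I x‖ ^ 2 ≤ ‖x‖ ^ 2 := by
  rw [norm_proj_sq, norm_sq_eq_sum]
  exact Finset.sum_le_sum_of_subset_of_nonneg (Finset.subset_univ _) (fun _ _ _ => sq_nonneg _)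

theorem norm_proj_sq_mono {d : ℕ} {I J : Finset (Fin d)} (h : I ⊆ J) (x : Vec d) :
    ‖proj I x‖ ^ 2 ≤ ‖proj J x‖ ^ 2 := by
  rw [norm_proj_sq, norm_proj_sq]
  exact Finset.sum_le_sum_of_subset_of_nonneg h (fun _ _ _ => sq_nonneg _)

theorem l0_proj_le {d : ℕ} (I : Finset (Fin d)) (x : Vec d) : l0 (proj I x) ≤ I.card :=
  l0_le_card (fun l hl => by rw [proj_apply, if_neg hl])

/-! ### One local step -/

/-- The empirical second moment of the features along `v`. -/
noncomputable def empMoment {d B : ℕ} (data : Fin B → Vec d × ℝ) (v : Vec d) : ℝ :=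
  1 / (B : ℝ) * ∑ j, inner ℝ (data j).1 v ^ 2

/-- The factor by which hard thresholding may expand distances. -/
noncomputable def htFactor (τ τs : ℕ) : ℝ := 1 + 2 * √(τs : ℝ) / √((τ : ℝ) - τs)

theorem norm_add_sq_le_mul {V : Type*} [NormedAddCommGroup V] [InnerProductSpace ℝ V] (a b : V)
    {u : ℝ} (hu : 0 < u) : ‖a + b‖ ^ 2 ≤ (1 + u) * ‖a‖ ^ 2 + (1 + 1 / u) * ‖b‖ ^ 2 := by
  have h1 : ‖a + b‖ ^ 2 ≤ (‖a‖ + ‖b‖) ^ 2 := by gcongr; exact norm_add_le a b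
  have h2 : (1 + u) * ‖a‖ ^ 2 + (1 + 1 / u) * ‖b‖ ^ 2 - (‖a‖ + ‖b‖) ^ 2
      = 1 / u * (u * ‖a‖ - ‖b‖) ^ 2 := by field_simp; ring
  have : 0 ≤ 1 / u * (u * ‖a‖ - ‖b‖) ^ 2 := by positivity
  linarith

/-- A projected exact gradient step contracts towards `xs`, up to the gradient at `xs`. -/
theorem norm_sub_proj_gradient_sq_le {d B : ℕ} {data : Fin B → Vec d × ℝ}
    {xs y : Vec d} {Clow Cup ρ l : ℝ} (hC0 : 0 < Clow) (hl : 0 < l) (I : Finset (Fin d))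
    (hxs : supp xs ⊆ I) (hy : supp y ⊆ I)
    (hcurv : ∀ j, ∀ x ∈ segment ℝ xs y, Clow ≤ logisticCurv (inner ℝ (data j).1 x) ∧
      logisticCurv (inner ℝ (data j).1 x) ≤ Cup)
    (hlow : ∀ v : Vec d, l0 v ≤ I.card → ρ * ‖v‖ ^ 2 ≤ Clow * empMoment data v)
    (hup : ∀ v : Vec d, l0 v ≤ I.card → Cup * empMoment data v ≤ l * ‖v‖ ^ 2) :
    ‖(y - xs) - (1 / (6 * l)) •
        proj I (∇ (clientLoss data) y - ∇ (clientLoss data) xs)‖ ^ 2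
      ≤ (1 - 11 / 36 * (ρ / l)) * ‖y - xs‖ ^ 2 := by
  set v := y - xs with hv
  choose w hw1 hw2 hw3 using fun j => exists_logisticProb_sub_eq (data j).1 xs y (hcurv j)
  set h := ∇ (clientLoss data) y - ∇ (clientLoss data) xs with hh
  have hinner : ∀ x : Vec d, inner ℝ x h
      = 1 / (B : ℝ) * ∑ j, w j * inner ℝ (data j).1 v * inner ℝ (data j).1 x := by
    intro x
    rw [hh, gradient_clientLoss, gradient_clientLoss, ← smul_sub, ← Finset.sum_sub_distrib,
      inner_smul_right, inner_sum]
    congr 1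
    refine Finset.sum_congr rfl (fun j _ => ?_)
    rw [obsGrad, obsGrad, ← sub_smul, sub_sub_sub_cancel_right, hw3 j, inner_smul_right,
      real_inner_comm (data j).1 x]
  have hvI : proj I v = v := by
    rw [hv, proj_sub, proj_eq_self hy, proj_eq_self hxs]
  have hvl : l0 v ≤ I.card := hvI ▸ l0_proj_le I v
  set g := proj I h with hg
  have hgl : l0 g ≤ I.card := l0_proj_le I h
  set a := inner ℝ v g with ha
  have ha1 : a = 1 / (B : ℝ) * ∑ j, w j * inner ℝ (data j).1 v ^ 2 := by
    rw [ha, hg, ← inner_proj_left, hvI, hinner]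
    congr 1
    exact Finset.sum_congr rfl (fun j _ => by ring)
  have hBinv : 0 ≤ 1 / (B : ℝ) := by positivity
  have ha2 : ρ * ‖v‖ ^ 2 ≤ a := by
    refine (hlow v hvl).trans ?_
    rw [ha1, empMoment, mul_left_comm, Finset.mul_sum]
    gcongr with j _
    exact hw1 j
  have hgg : ‖g‖ ^ 2 = 1 / (B : ℝ) * ∑ j, w j * inner ℝ (data j).1 v * inner ℝ (data j).1 g := by
    rw [← hinner, ← real_inner_self_eq_norm_sq]
    conv_lhs => rw [hg, ← inner_proj_left, proj_proj]
  -- Co-coercivity. Young's inequality in each summand gives `‖g‖² ≤ (l/2) a + (1/(2l)) Q(g)`, where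
  -- `Q` is the weighted second moment; `Q(g) ≤ l ‖g‖²` because `g` is sparse, so half of `‖g‖²` is
  -- absorbed on the left.
  have hg2 : ‖g‖ ^ 2 ≤ l * a := by
    have h1 : 1 / (B : ℝ) * ∑ j, w j * inner ℝ (data j).1 g ^ 2 ≤ l * ‖g‖ ^ 2 := by
      refine le_trans ?_ (hup g hgl)
      rw [empMoment, mul_left_comm, Finset.mul_sum _ _ Cup]
      gcongr with j _
      exact hw2 j
    have h2 : ‖g‖ ^ 2 ≤ l / 2 * a
        + 1 / (2 * l) * (1 / (B : ℝ) * ∑ j, w j * inner ℝ (data j).1 g ^ 2) := by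
      rw [hgg, ha1, mul_left_comm (l / 2), mul_left_comm (1 / (2 * l)), ← mul_add,
        Finset.mul_sum _ _ (l / 2), Finset.mul_sum _ _ (1 / (2 * l)), ← Finset.sum_add_distrib]
      gcongr with j _
      have h3 : l / 2 * (w j * inner ℝ (data j).1 v ^ 2)
          + 1 / (2 * l) * (w j * inner ℝ (data j).1 g ^ 2)
          - w j * inner ℝ (data j).1 v * inner ℝ (data j).1 g
          = w j * (1 / (2 * l)) * (l * inner ℝ (data j).1 v - inner ℝ (data j).1 g) ^ 2 := by
        field_simp; ring
      have h4 : 0 < w j := hC0.trans_le (hw1 j)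
      have : 0 ≤ w j * (1 / (2 * l)) * (l * inner ℝ (data j).1 v - inner ℝ (data j).1 g) ^ 2 := by
        positivity
      linarith
    have h5 : 1 / (2 * l) * (1 / (B : ℝ) * ∑ j, w j * inner ℝ (data j).1 g ^ 2)
        ≤ 1 / (2 * l) * (l * ‖g‖ ^ 2) := by gcongr
    have h6 : 1 / (2 * l) * (l * ‖g‖ ^ 2) = ‖g‖ ^ 2 / 2 := by field_simp
    linarith
  rw [norm_sub_sq_real, inner_smul_right, norm_smul, mul_pow, Real.norm_eq_abs, sq_abs, ← ha]
  -- Expanding the square with step `1/(6l)` leaves `-(1/3 - 1/36) a / l = -(11/36) a / l`.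
  have h7 : (1 / (6 * l)) ^ 2 * ‖g‖ ^ 2 ≤ (1 / (6 * l)) ^ 2 * (l * a) := by gcongr
  have h8 : (1 / (6 * l)) ^ 2 * (l * a) = 1 / 36 * (a / l) := by field_simp; ring
  have h9 : 2 * (1 / (6 * l) * a) = 1 / 3 * (a / l) := by field_simp; ring
  have h10 : ρ / l * ‖v‖ ^ 2 ≤ a / l := by
    rw [div_mul_eq_mul_div]; gcongr
  linarith

/-- Restricted to `I`, the union of the supports of the new point, `y` and `xs`, the step is an
exact projected step plus the errors at `xs` and from `g`; Young's inequality with weight `u`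
separates them. Since `I` depends on `g`, the bound `M` has to hold for every `J` of at most `2τ`
indices. -/
theorem norm_local_step_sq_le {d B τ : ℕ} {data : Fin B → Vec d × ℝ}
    {xs y : Vec d} {Clow Cup ρ l u M : ℝ} (hC0 : 0 < Clow) (hl : 0 < l) (hu : u = ρ / (12 * l))
    (hu0 : 0 < u) (hτ : l0 xs < τ) (hy : l0 y ≤ τ)
    (hcurv : ∀ j, ∀ x ∈ segment ℝ xs y, Clow ≤ logisticCurv (inner ℝ (data j).1 x) ∧
      logisticCurv (inner ℝ (data j).1 x) ≤ Cup)
    (hlow : ∀ v : Vec d, l0 v ≤ 2 * τ + l0 xs → ρ * ‖v‖ ^ 2 ≤ Clow * empMoment data v)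
    (hup : ∀ v : Vec d, l0 v ≤ 2 * τ + l0 xs → Cup * empMoment data v ≤ l * ‖v‖ ^ 2)
    (hM : ∀ J : Finset (Fin d), J.card ≤ 2 * τ →
      ‖proj (J ∪ supp xs) (∇ (clientLoss data) xs)‖ ^ 2 ≤ M) (g : Vec d) :
    ‖hardThreshold τ (y - (1 / (6 * l)) • g) - xs‖ ^ 2
      ≤ htFactor τ (l0 xs) * ((1 + u) * (1 - 11 / 3 * u) * ‖y - xs‖ ^ 2
        + (1 + 1 / u) * (1 / (6 * l)) ^ 2 * 2 * (M + ‖g - ∇ (clientLoss data) y‖ ^ 2)) := by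
  set γ := 1 / (6 * l) with hγ
  set H := hardThreshold τ (y - γ • g) with hH
  set J := supp H ∪ supp y with hJ
  set I := J ∪ supp xs with hI
  have hJc : J.card ≤ 2 * τ := by
    refine (Finset.card_union_le _ _).trans ?_
    rw [card_supp, card_supp]
    have : l0 H ≤ τ := l0_hardThreshold_le τ (y - γ • g)
    omega
  have hIc : I.card ≤ 2 * τ + l0 xs := by
    refine (Finset.card_union_le _ _).trans ?_
    rw [card_supp]
    omega
  have hHI : supp H ⊆ I := Finset.subset_union_left.trans Finset.subset_union_left
  have hyI : supp y ⊆ I := Finset.subset_union_right.trans Finset.subset_union_left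
  have hxI : supp xs ⊆ I := Finset.subset_union_right
  refine (norm_hardThreshold_sub_sq_le (y - γ • g) xs hτ I hHI hxI).trans ?_
  have hfac : (0 : ℝ) ≤ htFactor τ (l0 xs) := by unfold htFactor; positivity
  refine mul_le_mul_of_nonneg_left ?_ hfac
  set n := g - ∇ (clientLoss data) y with hn
  have hdec : proj I (y - γ • g) - xs
      = ((y - xs) - γ • proj I (∇ (clientLoss data) y - ∇ (clientLoss data) xs))
        + -(γ • (proj I (∇ (clientLoss data) xs) + proj I n)) := by
    rw [hn, proj_sub, proj_sub, proj_sub, proj_smul, proj_eq_self hyI]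
    module
  have hcon := norm_sub_proj_gradient_sq_le (data := data) hC0 hl I hxI hyI hcurv
    (fun v hv => hlow v (hv.trans hIc)) (fun v hv => hup v (hv.trans hIc))
  rw [hdec]
  refine (norm_add_sq_le_mul _ _ hu0).trans ?_
  have e1 : 11 / 36 * (ρ / l) = 11 / 3 * u := by rw [hu]; field_simp; ring
  rw [e1] at hcon
  rw [norm_neg, norm_smul, mul_pow, Real.norm_eq_abs, sq_abs]
  have h2 : ‖proj I (∇ (clientLoss data) xs) + proj I n‖ ^ 2 ≤ 2 * (M + ‖n‖ ^ 2) := by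
    have h3 := norm_add_sq_le_mul (proj I (∇ (clientLoss data) xs)) (proj I n) one_pos
    have h4 := hM J hJc
    have h5 := norm_proj_sq_le I n
    linarith
  calc _ ≤ (1 + u) * ((1 - 11 / 3 * u) * ‖y - xs‖ ^ 2)
        + (1 + 1 / u) * (γ ^ 2 * (2 * (M + ‖n‖ ^ 2))) := by gcongr
    _ = _ := by ring

/-! ### Uniform averages over finite product types -/

/-- Serves as the tower property: the inner average is the expectation given the past. -/
theorem expect_pi_snoc {n : ℕ} (α : Fin (n + 1) → Type) [∀ i, Fintype (α i)]
    (F : (∀ i, α i) → ℝ) :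
    Finset.expect Finset.univ (fun S : ∀ i, α i => F S)
      = Finset.expect Finset.univ (fun S : ∀ i : Fin n, α i.castSucc =>
          Finset.expect Finset.univ (fun x : α (Fin.last n) => F (Fin.snoc S x))) := by
  rw [← Fintype.expect_equiv (Fin.snocEquiv α) (fun p => F (Fin.snoc p.2 p.1)) F (fun p => rfl),
    ← Finset.univ_product_univ, Finset.expect_product, Finset.expect_comm]

theorem expect_pi_apply {ι Y : Type} [Fintype ι] [DecidableEq ι] [Fintype Y] [Nonempty Y] (i : ι)
    (g : Y → ℝ) :
    Finset.expect Finset.univ (fun S : ι → Y => g (S i)) = Finset.expect Finset.univ g := by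
  rw [Fintype.expect_equiv (Equiv.funSplitAt i Y) (fun S => g (S i)) (fun p => g p.1)
    (fun p => rfl), ← Finset.univ_product_univ, Finset.expect_product]
  simp

/-- Independent centred draws are orthogonal in mean, so each new draw adds its variance. -/
theorem expect_norm_sum_sq {V ι : Type} [NormedAddCommGroup V] [InnerProductSpace ℝ V]
    [Fintype ι] [Nonempty ι] (h : ι → V) (h0 : ∑ j, h j = 0) (m : ℕ) :
    Finset.expect Finset.univ (fun I : Fin m → ι => ‖∑ r, h (I r)‖ ^ 2)
      = m * Finset.expect Finset.univ (fun j => ‖h j‖ ^ 2) := by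
  induction m with
  | zero => simp
  | succ m ih =>
    rw [expect_pi_snoc (fun _ : Fin (m + 1) => ι)]
    have hstep : ∀ I : Fin m → ι, Finset.expect Finset.univ
        (fun x : ι => ‖∑ r, h ((Fin.snoc I x : Fin (m + 1) → ι) r)‖ ^ 2)
        = ‖∑ r, h (I r)‖ ^ 2 + Finset.expect Finset.univ (fun j => ‖h j‖ ^ 2) := by
      intro I
      have hx : ∀ x : ι, ‖∑ r, h ((Fin.snoc I x : Fin (m + 1) → ι) r)‖ ^ 2
          = ‖∑ r, h (I r)‖ ^ 2 + 2 * inner ℝ (∑ r, h (I r)) (h x) + ‖h x‖ ^ 2 := by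
        intro x
        rw [Fin.sum_univ_castSucc]
        simp only [Fin.snoc_castSucc, Fin.snoc_last]
        rw [norm_add_sq_real]
      simp only [hx]
      rw [Finset.expect_add_distrib, Finset.expect_add_distrib, Fintype.expect_const,
        ← Finset.mul_expect, Fintype.expect_eq_sum_div_card (fun x => inner ℝ _ (h x)),
        ← inner_sum, h0]
      simp
    calc _ = Finset.expect Finset.univ (fun I : Fin m → ι => ‖∑ r, h (I r)‖ ^ 2
          + Finset.expect Finset.univ (fun j => ‖h j‖ ^ 2)) :=
          Finset.expect_congr rfl (fun I _ => hstep I)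
      _ = _ := by
          rw [Finset.expect_add_distrib, Fintype.expect_const, ih]
          push_cast
          ring

/-- A minibatch gradient is the mean of `m` uniform draws whose average is the full gradient; the
variance of one draw is at most its second moment. -/
theorem expect_norm_gradient_batchLoss_sub_sq_le {d B m : ℕ} (hB : 0 < B) (hm : 0 < m)
    (data : Fin B → Vec d × ℝ) (Kz : ℝ) (y : Vec d) (hK : ∀ j, ‖obsGrad (data j) y‖ ≤ Kz) :
    Finset.expect Finset.univ (fun I : Fin m → Fin B =>
      ‖∇ (batchLoss data I) y - ∇ (clientLoss data) y‖ ^ 2) ≤ Kz ^ 2 / m := by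
  have : Nonempty (Fin B) := ⟨⟨0, hB⟩⟩
  have hBr : (B : ℝ) ≠ 0 := by exact_mod_cast hB.ne'
  have hmr : (m : ℝ) ≠ 0 := by exact_mod_cast hm.ne'
  set G := ∇ (clientLoss data) y with hG
  have hG' : (B : ℝ) • G = ∑ j, obsGrad (data j) y := by
    rw [hG, gradient_clientLoss, smul_smul, mul_one_div_cancel hBr, one_smul]
  set h : Fin B → Vec d := fun j => obsGrad (data j) y - G with hh
  have h0 : ∑ j, h j = 0 := by
    rw [hh, Finset.sum_sub_distrib, ← hG']
    simp [← Nat.cast_smul_eq_nsmul ℝ]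
  have hI : ∀ I : Fin m → Fin B, ‖∇ (batchLoss data I) y - G‖ ^ 2
      = (1 / (m : ℝ)) ^ 2 * ‖∑ r, h (I r)‖ ^ 2 := by
    intro I
    have : ∇ (batchLoss data I) y - G = (1 / (m : ℝ)) • ∑ r, h (I r) := by
      rw [gradient_batchLoss, hh, Finset.sum_sub_distrib, smul_sub]
      congr 1
      simp [← Nat.cast_smul_eq_nsmul ℝ, smul_smul, hmr]
    rw [this, norm_smul, mul_pow, Real.norm_eq_abs, sq_abs]
  simp only [hI]
  rw [← Finset.mul_expect, expect_norm_sum_sq h h0]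
  have hvar : Finset.expect Finset.univ (fun j => ‖h j‖ ^ 2) ≤ Kz ^ 2 := by
    have hx : ∀ j, ‖h j‖ ^ 2 = ‖obsGrad (data j) y‖ ^ 2 - 2 * inner ℝ G (obsGrad (data j) y)
        + ‖G‖ ^ 2 := fun j => by
      rw [hh, norm_sub_sq_real, real_inner_comm]
    have h1 : Finset.expect Finset.univ (fun j => inner ℝ G (obsGrad (data j) y)) = ‖G‖ ^ 2 := by
      rw [Fintype.expect_eq_sum_div_card, ← inner_sum, ← hG', inner_smul_right,
        real_inner_self_eq_norm_sq, Fintype.card_fin]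
      field_simp
    have h2 : Finset.expect Finset.univ (fun j => ‖obsGrad (data j) y‖ ^ 2) ≤ Kz ^ 2 :=
      Finset.expect_le Finset.univ_nonempty (fun j _ => by gcongr; exact hK j)
    simp only [hx]
    rw [Finset.expect_add_distrib, Finset.expect_sub_distrib, ← Finset.mul_expect, h1,
      Fintype.expect_const]
    linarith [sq_nonneg ‖G‖]
  calc (1 / (m : ℝ)) ^ 2 * (m * Finset.expect Finset.univ (fun j => ‖h j‖ ^ 2))
      ≤ (1 / (m : ℝ)) ^ 2 * (m * Kz ^ 2) := by gcongr
    _ = _ := by field_simp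

/-! ### The local phase of a round -/

/-- The curvature condition of a client on the segment from `xs` to `y`. -/
def CurvatureAt {d B : ℕ} (Clow Cup : ℝ) (xs : Vec d) (data : Fin B → Vec d × ℝ) (y : Vec d) :
    Prop :=
  ∀ j, ∀ x ∈ segment ℝ xs y, Clow ≤ logisticCurv (inner ℝ (data j).1 x) ∧
    logisticCurv (inner ℝ (data j).1 x) ≤ Cup

/-- The curvature condition of a client along `k` local steps from `x`. -/
def LocalCurvature {d B m : ℕ} (Clow Cup : ℝ) (xs : Vec d) (τ : ℕ) (γ : ℝ)
    (data : Fin B → Vec d × ℝ) (k : ℕ) (S : Fin k → Fin m → Fin B) (x : Vec d) : Prop :=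
  ∀ k' : Fin k, CurvatureAt Clow Cup xs data
    (localIterate τ γ data k' (fun l => S (l.castLE k'.isLt.le)) x)

theorem localIterate_snoc {d B m : ℕ} (τ : ℕ) (γ : ℝ) (data : Fin B → Vec d × ℝ) (k : ℕ)
    (S : Fin k → Fin m → Fin B) (I : Fin m → Fin B) (x : Vec d) :
    localIterate τ γ data (k + 1) (Fin.snoc S I : Fin (k + 1) → Fin m → Fin B) x
      = hardThreshold τ (localIterate τ γ data k S x
          - γ • ∇ (batchLoss data I) (localIterate τ γ data k S x)) := by
  simp only [localIterate, Fin.snoc_castSucc, Fin.snoc_last]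

theorem l0_localIterate_le {d B m : ℕ} (τ : ℕ) (γ : ℝ) (data : Fin B → Vec d × ℝ) (k : ℕ)
    (S : Fin k → Fin m → Fin B) (x : Vec d) (hx : l0 x ≤ τ) :
    l0 (localIterate τ γ data k S x) ≤ τ := by
  cases k with
  | zero => exact hx
  | succ k => exact l0_hardThreshold_le _ _

/-- The condition tests the points from which steps start. For `k + 1` steps it therefore covers the
iterate after `k` steps but not the last one, and it never involves the last batch. -/
theorem LocalCurvature.of_snoc {d B m : ℕ} {Clow Cup : ℝ} {xs : Vec d} {τ : ℕ} {γ : ℝ}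
    {data : Fin B → Vec d × ℝ} {k : ℕ} {S : Fin k → Fin m → Fin B} {I : Fin m → Fin B} {x : Vec d}
    (h : LocalCurvature Clow Cup xs τ γ data (k + 1)
      (Fin.snoc S I : Fin (k + 1) → Fin m → Fin B) x) :
    LocalCurvature Clow Cup xs τ γ data k S x ∧
      CurvatureAt Clow Cup xs data (localIterate τ γ data k S x) := by
  have hs : ∀ q : Fin k, (Fin.snoc S I : Fin (k + 1) → Fin m → Fin B) q.castSucc = S q :=
    fun q => Fin.snoc_castSucc (α := fun _ => Fin m → Fin B) I S q
  constructor
  · intro k'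
    have h1 := h k'.castSucc
    have h2 : (fun l : Fin k' => (Fin.snoc S I : Fin (k + 1) → Fin m → Fin B)
        (l.castLE k'.castSucc.isLt.le)) = fun l => S (l.castLE k'.isLt.le) :=
      funext (fun l => hs (l.castLE k'.isLt.le))
    rw [← h2]
    exact h1
  · have h1 := h (Fin.last k)
    have h2 : (fun l : Fin k => (Fin.snoc S I : Fin (k + 1) → Fin m → Fin B)
        (l.castLE (Fin.last k).isLt.le)) = S := funext hs
    rw [← h2]
    exact h1

/-- Given the first `k` batches, either the curvature condition holds at the current point and
`hstep` applies, or the indicator vanishes for every next batch. The additive errors sum to at most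
`c / u`, which is the fixed point of `e ↦ (1 - u) e + c`. -/
theorem expect_localIterate_le {d B m : ℕ} (hB : 0 < B) {Clow Cup : ℝ} {xs : Vec d} {τ : ℕ}
    {γ : ℝ} {data : Fin B → Vec d × ℝ} {q u c : ℝ} (hq0 : 0 ≤ q) (hu : 0 < u) (hq : q ≤ 1 - u)
    (hc : 0 ≤ c)
    (hstep : ∀ y : Vec d, l0 y ≤ τ → CurvatureAt Clow Cup xs data y →
      Finset.expect Finset.univ (fun I : Fin m → Fin B =>
        ‖hardThreshold τ (y - γ • ∇ (batchLoss data I) y) - xs‖ ^ 2) ≤ q * ‖y - xs‖ ^ 2 + c)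
    (x : Vec d) (hx : l0 x ≤ τ) (k : ℕ) :
    Finset.expect Finset.univ (fun S : Fin k → Fin m → Fin B =>
      Set.indicator {S | LocalCurvature Clow Cup xs τ γ data k S x}
        (fun S => ‖localIterate τ γ data k S x - xs‖ ^ 2) S) ≤ q ^ k * ‖x - xs‖ ^ 2 + c / u := by
  have : Nonempty (Fin B) := ⟨⟨0, hB⟩⟩
  induction k with
  | zero =>
    have hcu : 0 ≤ c / u := by positivity
    refine Finset.expect_le Finset.univ_nonempty (fun S _ => ?_)
    refine (Set.indicator_le_self' (fun _ _ => by positivity) S).trans ?_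
    simp only [localIterate, pow_zero, one_mul]
    linarith
  | succ k ih =>
    rw [expect_pi_snoc (fun _ : Fin (k + 1) => Fin m → Fin B)]
    have hS : ∀ S : Fin k → Fin m → Fin B, Finset.expect Finset.univ (fun I : Fin m → Fin B =>
        Set.indicator {S | LocalCurvature Clow Cup xs τ γ data (k + 1) S x}
          (fun S => ‖localIterate τ γ data (k + 1) S x - xs‖ ^ 2) (Fin.snoc S I))
        ≤ q * Set.indicator {S | LocalCurvature Clow Cup xs τ γ data k S x}
          (fun S => ‖localIterate τ γ data k S x - xs‖ ^ 2) S + c := by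
      intro S
      by_cases h : LocalCurvature Clow Cup xs τ γ data k S x ∧
          CurvatureAt Clow Cup xs data (localIterate τ γ data k S x)
      · rw [Set.indicator_of_mem (by exact h.1)]
        refine le_trans (Finset.expect_le_expect (fun I _ => ?_))
          (hstep _ (l0_localIterate_le τ γ data k S x hx) h.2)
        refine (Set.indicator_le_self' (fun _ _ => by positivity) _).trans ?_
        rw [localIterate_snoc]
      · have h0 : 0 ≤ Set.indicator {S | LocalCurvature Clow Cup xs τ γ data k S x}
          (fun S => ‖localIterate τ γ data k S x - xs‖ ^ 2) S :=
          Set.indicator_nonneg (fun _ _ => by positivity) _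
        refine le_trans (Finset.expect_le Finset.univ_nonempty (fun I _ => ?_))
          (add_nonneg (mul_nonneg hq0 h0) hc)
        rw [Set.indicator_of_notMem]
        exact fun hmem => h hmem.of_snoc
    refine (Finset.expect_le_expect (fun S _ => hS S)).trans ?_
    rw [Finset.expect_add_distrib, Fintype.expect_const, ← Finset.mul_expect]
    calc _ ≤ q * (q ^ k * ‖x - xs‖ ^ 2 + c / u) + c := by gcongr
      _ = q ^ (k + 1) * ‖x - xs‖ ^ 2 + (q * (c / u) + c) := by ring
      _ ≤ q ^ (k + 1) * ‖x - xs‖ ^ 2 + ((1 - u) * (c / u) + c) := by gcongr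
      _ = _ := by field_simp; ring

/-! ### Rounds -/

theorem norm_mean_sub_sq_le {d N : ℕ} (hN : 0 < N) (x : Fin N → Vec d) (xs : Vec d) :
    ‖∑ i, (1 / (N : ℝ)) • x i - xs‖ ^ 2 ≤ 1 / (N : ℝ) * ∑ i, ‖x i - xs‖ ^ 2 := by
  have hNr : (N : ℝ) ≠ 0 := by exact_mod_cast hN.ne'
  have h1 : ∑ i, (1 / (N : ℝ)) • x i - xs = (1 / (N : ℝ)) • ∑ i, (x i - xs) := by
    rw [Finset.sum_sub_distrib, smul_sub, Finset.smul_sum]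
    congr 1
    simp [← Nat.cast_smul_eq_nsmul ℝ, smul_smul, hNr]
  rw [h1, norm_smul, mul_pow, Real.norm_eq_abs, sq_abs]
  have h2 : ‖∑ i, (x i - xs)‖ ^ 2 ≤ (N : ℝ) * ∑ i, ‖x i - xs‖ ^ 2 := by
    have h3 := sq_sum_le_card_mul_sum_sq (s := Finset.univ) (f := fun i => ‖x i - xs‖)
    rw [Finset.card_univ, Fintype.card_fin] at h3
    refine le_trans ?_ h3
    gcongr
    exact norm_sum_le _ _
  calc _ ≤ (1 / (N : ℝ)) ^ 2 * ((N : ℝ) * ∑ i, ‖x i - xs‖ ^ 2) := by gcongr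
    _ = _ := by field_simp

theorem l0_fedIterHT_le {d N B : ℕ} (τ K : ℕ) (γ : ℝ) (b : ℕ → ℕ)
    (data : Fin N → Fin B → Vec d × ℝ) (x0 : Vec d) (hx0 : l0 x0 ≤ τ) (T : ℕ)
    (S : Batches N B K b T) : l0 (fedIterHT τ K γ b data x0 T S) ≤ τ := by
  cases T with
  | zero => exact hx0
  | succ T => exact l0_hardThreshold_le _ _

/-- The runs of `T + 1` rounds, from the runs of `T` rounds and the last round. -/
def snocRound {N B K : ℕ} {b : ℕ → ℕ} {T : ℕ} (S : Batches N B K b T)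
    (R : Fin N → Fin K → Fin (b T) → Fin B) : Batches N B K b (T + 1) :=
  Fin.snoc (α := fun t : Fin (T + 1) => Fin N → Fin K → Fin (b t) → Fin B) S R

theorem snocRound_castSucc {N B K : ℕ} {b : ℕ → ℕ} {T : ℕ} (S : Batches N B K b T)
    (R : Fin N → Fin K → Fin (b T) → Fin B) (t : Fin T) : snocRound S R t.castSucc = S t :=
  Fin.snoc_castSucc (α := fun t : Fin (T + 1) => Fin N → Fin K → Fin (b t) → Fin B) R S t

theorem snocRound_last {N B K : ℕ} {b : ℕ → ℕ} {T : ℕ} (S : Batches N B K b T)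
    (R : Fin N → Fin K → Fin (b T) → Fin B) : snocRound S R (Fin.last T) = R :=
  Fin.snoc_last (α := fun t : Fin (T + 1) => Fin N → Fin K → Fin (b t) → Fin B) R S

theorem fedIterHT_snocRound {d N B : ℕ} (τ K : ℕ) (γ : ℝ) (b : ℕ → ℕ)
    (data : Fin N → Fin B → Vec d × ℝ) (x0 : Vec d) (T : ℕ) (S : Batches N B K b T)
    (R : Fin N → Fin K → Fin (b T) → Fin B) :
    fedIterHT τ K γ b data x0 (T + 1) (snocRound S R)
      = hardThreshold τ (∑ i, (1 / (N : ℝ)) • localIterate τ γ (data i) K (R i)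
          (fedIterHT τ K γ b data x0 T S)) := by
  have h : (fun t : Fin T => snocRound S R t.castSucc) = S := funext (snocRound_castSucc S R)
  simp only [fedIterHT, snocRound_last]
  rw [h]

theorem CurvatureAlong.of_snocRound {d N B : ℕ} {Clow Cup : ℝ} {xs : Vec d} {τ K : ℕ} {γ : ℝ}
    {b : ℕ → ℕ} {data : Fin N → Fin B → Vec d × ℝ} {x0 : Vec d} {T : ℕ}
    {S : Batches N B K b T} {R : Fin N → Fin K → Fin (b T) → Fin B}
    (h : CurvatureAlong Clow Cup xs τ K γ b data x0 (snocRound S R)) :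
    CurvatureAlong Clow Cup xs τ K γ b data x0 S ∧
      ∀ i, LocalCurvature Clow Cup xs τ γ (data i) K (R i) (fedIterHT τ K γ b data x0 T S) := by
  constructor
  · intro t i k j x hx
    refine h t.castSucc i k j x ?_
    have e : localPoint τ K γ b data x0 (snocRound S R) t.castSucc i k
        = localPoint τ K γ b data x0 S t i k := by
      have h2 : (fun r : Fin t => snocRound S R (r.castLE t.castSucc.isLt.le))
          = fun r : Fin t => S (r.castLE t.isLt.le) :=
        funext (fun r => snocRound_castSucc S R (r.castLE t.isLt.le))
      unfold localPoint
      rw [snocRound_castSucc]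
      exact congrArg _ (congrArg (fedIterHT τ K γ b data x0 t) h2)
    rw [e]
    exact hx
  · intro i k j x hx
    refine h (Fin.last T) i k j x ?_
    have e : localPoint τ K γ b data x0 (snocRound S R) (Fin.last T) i k
        = localIterate τ γ (data i) k (fun l => R i (l.castLE k.isLt.le))
            (fedIterHT τ K γ b data x0 T S) := by
      have h2 : (fun r : Fin T => snocRound S R (r.castLE (Fin.last T).isLt.le)) = S :=
        funext (snocRound_castSucc S R)
      unfold localPoint
      rw [snocRound_last]
      exact congrArg _ (congrArg (fedIterHT τ K γ b data x0 T) h2)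
    rw [e]
    exact hx

theorem norm_hardThreshold_sub_sq_le_htFactor {d τ : ℕ} (u xs : Vec d) (hτ : l0 xs < τ) :
    ‖hardThreshold τ u - xs‖ ^ 2 ≤ htFactor τ (l0 xs) * ‖u - xs‖ ^ 2 := by
  have h := norm_hardThreshold_sub_sq_le u xs hτ Finset.univ (Finset.subset_univ _)
    (Finset.subset_univ _)
  rwa [proj_eq_self (Finset.subset_univ _)] at h

/-- The mean squared error after `T` rounds, on the runs that satisfy the curvature condition. -/
noncomputable def restrictedError {d N B : ℕ} (Clow Cup : ℝ) (xs : Vec d) (τ K : ℕ) (γ : ℝ)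
    (b : ℕ → ℕ) (data : Fin N → Fin B → Vec d × ℝ) (x0 : Vec d) (T : ℕ) : ℝ :=
  Finset.expect Finset.univ (fun S : Batches N B K b T =>
    Set.indicator {S | CurvatureAlong Clow Cup xs τ K γ b data x0 S}
      (fun S => ‖fedIterHT τ K γ b data x0 T S - xs‖ ^ 2) S)

/-- Server thresholding costs one `htFactor`, and convexity reduces the averaged iterate to the
clients. The curvature event implies each client's own event, which depends on that client's batches
alone; these are uniform by `expect_pi_apply`. -/
theorem restrictedError_succ_le {d N B : ℕ} (hN : 0 < N) (hB : 0 < B) {Clow Cup : ℝ} {xs : Vec d}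
    {τ K : ℕ} {γ : ℝ} {b : ℕ → ℕ} {data : Fin N → Fin B → Vec d × ℝ} {x0 : Vec d} {q u : ℝ}
    {c : Fin N → ℝ} (hK : 1 ≤ K) (hτ : l0 xs < τ) (hx0 : l0 x0 ≤ τ)
    (hq0 : 0 ≤ q) (hu : 0 < u) (hq : q ≤ 1 - u) (hc : ∀ i, 0 ≤ c i) (T : ℕ)
    (hstep : ∀ i, ∀ y : Vec d, l0 y ≤ τ → CurvatureAt Clow Cup xs (data i) y →
      Finset.expect Finset.univ (fun I : Fin (b T) → Fin B =>
        ‖hardThreshold τ (y - γ • ∇ (batchLoss (data i) I) y) - xs‖ ^ 2)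
          ≤ q * ‖y - xs‖ ^ 2 + c i) :
    restrictedError Clow Cup xs τ K γ b data x0 (T + 1)
      ≤ htFactor τ (l0 xs) * (q * restrictedError Clow Cup xs τ K γ b data x0 T
          + 1 / (N : ℝ) * ∑ i, c i / u) := by
  have hBn : Nonempty (Fin B) := ⟨⟨0, hB⟩⟩
  have hNr : (N : ℝ) ≠ 0 := by exact_mod_cast hN.ne'
  have hfac : (0 : ℝ) ≤ htFactor τ (l0 xs) := by unfold htFactor; positivity
  have hcu : 0 ≤ 1 / (N : ℝ) * ∑ i, c i / u :=
    mul_nonneg (by positivity) (Finset.sum_nonneg (fun i _ => div_nonneg (hc i) hu.le))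
  -- A single factor is kept, so the final bound does not depend on `K`.
  have hqK : q ^ K ≤ q := by
    have := pow_le_pow_of_le_one hq0 (by linarith) hK
    simpa using this
  unfold restrictedError
  rw [expect_pi_snoc (fun t : Fin (T + 1) => Fin N → Fin K → Fin (b t) → Fin B)]
  have hS : ∀ S : Batches N B K b T, Finset.expect Finset.univ
      (fun R : Fin N → Fin K → Fin (b T) → Fin B =>
        Set.indicator {S | CurvatureAlong Clow Cup xs τ K γ b data x0 S}
          (fun S => ‖fedIterHT τ K γ b data x0 (T + 1) S - xs‖ ^ 2) (snocRound S R))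
      ≤ htFactor τ (l0 xs) * (q * Set.indicator
          {S | CurvatureAlong Clow Cup xs τ K γ b data x0 S}
          (fun S => ‖fedIterHT τ K γ b data x0 T S - xs‖ ^ 2) S
          + 1 / (N : ℝ) * ∑ i, c i / u) := by
    intro S
    by_cases h : CurvatureAlong Clow Cup xs τ K γ b data x0 S
    · rw [Set.indicator_of_mem (by exact h)]
      set x := fedIterHT τ K γ b data x0 T S with hx
      let F : Fin N → (Fin K → Fin (b T) → Fin B) → ℝ := fun i =>
        Set.indicator {S | LocalCurvature Clow Cup xs τ γ (data i) K S x}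
          (fun S => ‖localIterate τ γ (data i) K S x - xs‖ ^ 2)
      have hF0 : ∀ i S, 0 ≤ F i S := fun i S => Set.indicator_nonneg (fun _ _ => by positivity) _
      have hR : ∀ R : Fin N → Fin K → Fin (b T) → Fin B,
          Set.indicator {S | CurvatureAlong Clow Cup xs τ K γ b data x0 S}
            (fun S => ‖fedIterHT τ K γ b data x0 (T + 1) S - xs‖ ^ 2) (snocRound S R)
          ≤ htFactor τ (l0 xs) * (1 / (N : ℝ) * ∑ i, F i (R i)) := by
        intro R
        by_cases hR : CurvatureAlong Clow Cup xs τ K γ b data x0 (snocRound S R)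
        · rw [Set.indicator_of_mem (by exact hR), fedIterHT_snocRound]
          refine (norm_hardThreshold_sub_sq_le_htFactor _ xs hτ).trans ?_
          refine mul_le_mul_of_nonneg_left ((norm_mean_sub_sq_le hN _ xs).trans (le_of_eq ?_)) hfac
          congr 1
          refine Finset.sum_congr rfl (fun i _ => ?_)
          exact (Set.indicator_of_mem
            (s := {S | LocalCurvature Clow Cup xs τ γ (data i) K S x}) (a := R i)
            (hR.of_snocRound.2 i) (fun S => ‖localIterate τ γ (data i) K S x - xs‖ ^ 2)).symm
        · rw [Set.indicator_of_notMem (by exact hR)]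
          exact mul_nonneg hfac (mul_nonneg (by positivity)
            (Finset.sum_nonneg (fun i _ => hF0 i _)))
      refine (Finset.expect_le_expect (fun R _ => hR R)).trans ?_
      rw [← Finset.mul_expect, ← Finset.mul_expect, Finset.expect_sum_comm]
      refine mul_le_mul_of_nonneg_left ?_ hfac
      have hi : ∀ i, Finset.expect Finset.univ
          (fun R : Fin N → Fin K → Fin (b T) → Fin B => F i (R i))
          ≤ q * ‖x - xs‖ ^ 2 + c i / u := by
        intro i
        rw [expect_pi_apply i (F i)]
        refine (expect_localIterate_le hB hq0 hu hq (hc i) (hstep i) x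
          (l0_fedIterHT_le τ K γ b data x0 hx0 T S) K).trans ?_
        gcongr
      calc _ ≤ 1 / (N : ℝ) * ∑ i : Fin N, (q * ‖x - xs‖ ^ 2 + c i / u) := by
            gcongr with i _
            exact hi i
        _ = _ := by
            rw [Finset.sum_add_distrib, mul_add]
            congr 1
            simp only [Finset.sum_const, Finset.card_univ, Fintype.card_fin, nsmul_eq_mul]
            field_simp
    · have h0 : 0 ≤ Set.indicator {S | CurvatureAlong Clow Cup xs τ K γ b data x0 S}
          (fun S => ‖fedIterHT τ K γ b data x0 T S - xs‖ ^ 2) S :=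
        Set.indicator_nonneg (fun _ _ => by positivity) _
      refine le_trans (Finset.expect_le Finset.univ_nonempty (fun R _ => ?_))
        (mul_nonneg hfac (add_nonneg (mul_nonneg hq0 h0) hcu))
      rw [Set.indicator_of_notMem]
      exact fun hmem => h hmem.of_snocRound.1
  refine (Finset.expect_le_expect (fun S _ => hS S)).trans (le_of_eq ?_)
  rw [← Finset.mul_expect, Finset.expect_add_distrib, Fintype.expect_const, ← Finset.mul_expect]

/-- The mean squared error contracts up to the gradient at `xs` and the minibatch noise. -/
theorem restrictedError_succ_le_of_moments {d N B : ℕ} (hN : 0 < N) (hB : 0 < B)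
    {Clow Cup ρ l u Kz Mb θ Γ : ℝ} {xs : Vec d} {τ K : ℕ} {b : ℕ → ℕ}
    {data : Fin N → Fin B → Vec d × ℝ} {x0 : Vec d} {M : Fin N → ℝ}
    (hK : 1 ≤ K) (hτ : l0 xs < τ) (hx0 : l0 x0 ≤ τ) (hC0 : 0 < Clow) (hl : 0 < l)
    (hu : u = ρ / (12 * l)) (hu0 : 0 < u) (hu1 : u ≤ 1 / 18)
    (hfac : htFactor τ (l0 xs) ^ 2 * (1 - u) ≤ 1)
    (hz : ∀ i j, ‖(data i j).1‖ ≤ Kz) (hy : ∀ i j, 0 ≤ (data i j).2 ∧ (data i j).2 ≤ 1)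
    (hlow : ∀ i, ∀ v : Vec d, l0 v ≤ 2 * τ + l0 xs →
      ρ * ‖v‖ ^ 2 ≤ Clow * empMoment (data i) v)
    (hup : ∀ i, ∀ v : Vec d, l0 v ≤ 2 * τ + l0 xs →
      Cup * empMoment (data i) v ≤ l * ‖v‖ ^ 2)
    (hM : ∀ i, ∀ J : Finset (Fin d), J.card ≤ 2 * τ →
      ‖proj (J ∪ supp xs) (∇ (clientLoss (data i)) xs)‖ ^ 2 ≤ M i)
    (hMb : 1 / (N : ℝ) * ∑ i, M i ≤ Mb) (T : ℕ) (hb : 0 < b T) (hbθ : 1 / (b T : ℝ) ≤ θ ^ T / Γ) :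
    restrictedError Clow Cup xs τ K (1 / (6 * l)) b data x0 (T + 1)
      ≤ (1 - u) * restrictedError Clow Cup xs τ K (1 / (6 * l)) b data x0 T
        + 4 * (1 + 1 / u) * (1 / (6 * l)) ^ 2 / u * (Mb + Kz ^ 2 / Γ * θ ^ T) := by
  have hBn : Nonempty (Fin B) := ⟨⟨0, hB⟩⟩
  set γ := 1 / (6 * l) with hγ
  set H := htFactor τ (l0 xs) with hH
  have hH1 : 1 ≤ H := by
    have : 0 ≤ 2 * √(l0 xs : ℝ) / √((τ : ℝ) - l0 xs) := by positivity
    rw [hH, htFactor]; linarith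
  set κ₂ := (1 + 1 / u) * γ ^ 2 * 2 with hκ₂
  have hκ₂0 : 0 ≤ κ₂ := by positivity
  set p := (1 + u) * (1 - 11 / 3 * u) with hp
  have hp0 : 0 ≤ p := mul_nonneg (by linarith) (by linarith)
  -- Here `p = 1 - 8u/3 - 11u²/3`. Of the two factors `1 - u`, one cancels `H²` (local and server
  -- thresholding) and the other is the net rate of a round.
  have hp1 : p ≤ (1 - u) ^ 2 := by rw [hp]; nlinarith
  have hHp : H ^ 2 * p ≤ 1 - u := by
    calc H ^ 2 * p ≤ H ^ 2 * (1 - u) ^ 2 := by gcongr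
      _ = (H ^ 2 * (1 - u)) * (1 - u) := by ring
      _ ≤ 1 * (1 - u) := by
          apply mul_le_mul_of_nonneg_right hfac; linarith
      _ = 1 - u := one_mul _
  have hHq : H * p ≤ 1 - u := by
    refine le_trans ?_ hHp
    gcongr
    nlinarith
  -- From `H² (1 - u) ≤ 1` and `u ≤ 1/18`; this turns the factor 2 in `κ₂` into the 4 of the
  -- statement.
  have hH2 : H ^ 2 ≤ 2 := by nlinarith [sq_nonneg H]
  have hM0 : ∀ i, 0 ≤ M i := fun i => (sq_nonneg _).trans (hM i ∅ (by simp))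
  have hbr : (0 : ℝ) < b T := by exact_mod_cast hb
  have hstep : ∀ i, ∀ y : Vec d, l0 y ≤ τ → CurvatureAt Clow Cup xs (data i) y →
      Finset.expect Finset.univ (fun I : Fin (b T) → Fin B =>
        ‖hardThreshold τ (y - γ • ∇ (batchLoss (data i) I) y) - xs‖ ^ 2)
          ≤ H * p * ‖y - xs‖ ^ 2 + H * (κ₂ * (M i + Kz ^ 2 / b T)) := by
    intro i y hyτ hcurv
    have hpt : ∀ I : Fin (b T) → Fin B,
        ‖hardThreshold τ (y - γ • ∇ (batchLoss (data i) I) y) - xs‖ ^ 2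
        ≤ H * (p * ‖y - xs‖ ^ 2 + κ₂ * (M i
          + ‖∇ (batchLoss (data i) I) y - ∇ (clientLoss (data i)) y‖ ^ 2)) := fun I =>
      norm_local_step_sq_le hC0 hl hu hu0 hτ hyτ hcurv (hlow i) (hup i) (hM i) _
    refine (Finset.expect_le_expect (fun I _ => hpt I)).trans ?_
    rw [← Finset.mul_expect, Finset.expect_add_distrib, Fintype.expect_const, ← Finset.mul_expect,
      Finset.expect_add_distrib, Fintype.expect_const, mul_add, mul_assoc H p]
    gcongr
    exact expect_norm_gradient_batchLoss_sub_sq_le hB hb (data i) Kz y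
      (fun j => norm_obsGrad_le (hz i j) (hy i j) y)
  refine (restrictedError_succ_le hN hB hK hτ hx0 (by positivity) hu0 hHq (fun i => ?_) T
    hstep).trans ?_
  · have := hM0 i
    positivity
  · set a := restrictedError Clow Cup xs τ K γ b data x0 T with ha
    have ha0 : 0 ≤ a := Finset.expect_nonneg
      (fun S _ => Set.indicator_nonneg (fun _ _ => by positivity) _)
    have hNr : (N : ℝ) ≠ 0 := by exact_mod_cast hN.ne'
    have hsum : 1 / (N : ℝ) * ∑ i, H * (κ₂ * (M i + Kz ^ 2 / b T)) / u
        = H * κ₂ / u * (1 / (N : ℝ) * ∑ i, M i + Kz ^ 2 / b T) := by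
      have : ∀ i, H * (κ₂ * (M i + Kz ^ 2 / b T)) / u
          = H * κ₂ / u * (M i + Kz ^ 2 / b T) := fun i => by ring
      simp only [this]
      rw [← Finset.mul_sum, Finset.sum_add_distrib]
      simp only [Finset.sum_const, Finset.card_univ, Fintype.card_fin, nsmul_eq_mul]
      field_simp
    rw [hsum]
    have hnoise : Kz ^ 2 / b T ≤ Kz ^ 2 / Γ * θ ^ T := by
      calc Kz ^ 2 / b T = Kz ^ 2 * (1 / b T) := by ring
        _ ≤ Kz ^ 2 * (θ ^ T / Γ) := by gcongr
        _ = _ := by ring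
    have hMavg : 0 ≤ 1 / (N : ℝ) * ∑ i, M i :=
      mul_nonneg (by positivity) (Finset.sum_nonneg (fun i _ => hM0 i))
    have hK0 : 0 ≤ Kz ^ 2 / (b T : ℝ) := by positivity
    calc H * (H * p * a + H * κ₂ / u * (1 / (N : ℝ) * ∑ i, M i + Kz ^ 2 / b T))
        = H ^ 2 * p * a + H ^ 2 * (κ₂ / u) * (1 / (N : ℝ) * ∑ i, M i + Kz ^ 2 / b T) := by ring
      _ ≤ (1 - u) * a + 2 * (κ₂ / u) * (Mb + Kz ^ 2 / Γ * θ ^ T) := by gcongr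
      _ = _ := by rw [hκ₂]; ring

/-- The constant part settles at the fixed point `c m / (1 - r)`. Comparing with a ratio `φ`
strictly above `r` avoids the resonant term `T r ^ T` that `θ = r` would produce. -/
theorem le_geometric_of_recursion {a : ℕ → ℝ} {r θ φ c m σ : ℝ} (hr0 : 0 ≤ r) (hr1 : r < 1)
    (hrφ : r < φ) (hθ0 : 0 ≤ θ) (hθφ : θ ≤ φ) (hc : 0 ≤ c) (hσ : 0 ≤ σ) (hm : 0 ≤ m)
    (ha0 : 0 ≤ a 0) (h : ∀ T, a (T + 1) ≤ r * a T + c * (m + σ * θ ^ T)) (T : ℕ) :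
    a T ≤ (a 0 + c * σ / (φ - r)) * φ ^ T + c * m / (1 - r) := by
  have hφr : 0 < φ - r := by linarith
  have h1r : 0 < 1 - r := by linarith
  induction T with
  | zero =>
    have h1 : 0 ≤ c * σ / (φ - r) := by positivity
    have h2 : 0 ≤ c * m / (1 - r) := by positivity
    simp only [pow_zero, mul_one]
    linarith
  | succ T ih =>
    have hφT : θ ^ T ≤ φ ^ T := by gcongr
    have hφ0 : 0 ≤ φ ^ T := pow_nonneg (hθ0.trans hθφ) T
    calc a (T + 1) ≤ r * a T + c * (m + σ * θ ^ T) := h T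
      _ ≤ r * ((a 0 + c * σ / (φ - r)) * φ ^ T + c * m / (1 - r)) + c * (m + σ * φ ^ T) := by
          gcongr
      _ = (r * a 0 + c * σ * (r / (φ - r) + 1)) * φ ^ T + c * m * (r / (1 - r) + 1) := by ring
      _ = (r * a 0 + c * σ * (φ / (φ - r))) * φ ^ T + c * m * (1 / (1 - r)) := by
          congr 2
          · congr 2; field_simp; ring
          · field_simp; ring
      _ ≤ (φ * a 0 + c * σ * (φ / (φ - r))) * φ ^ T + c * m * (1 / (1 - r)) := by gcongr
      _ = _ := by ring

/-- Local dissimilarity controls the worst restricted gradients of the clients. -/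
theorem exists_client_gradient_bounds {d N B : ℕ} (hN : 0 < N)
    {data : Fin N → Fin B → Vec d × ℝ} {xs : Vec d} {Bdis t : ℝ} (τ : ℕ)
    (hdis : LocallyDissimilarAt data Bdis xs) (ht : 0 ≤ t)
    (hgrad : ∀ l, (∇ (globalLoss data) xs) l ^ 2 ≤ t) :
    ∃ M : Fin N → ℝ, (∀ i, ∀ J : Finset (Fin d), J.card ≤ 2 * τ →
        ‖proj (J ∪ supp xs) (∇ (clientLoss (data i)) xs)‖ ^ 2 ≤ M i) ∧
      1 / (N : ℝ) * ∑ i, M i ≤ Bdis ^ 2 * ((2 * N * τ + l0 xs) * t) := by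
  have hex : ∀ i, ∃ J : Finset (Fin d), J.card ≤ 2 * τ ∧ ∀ J' : Finset (Fin d),
      J'.card ≤ 2 * τ → ‖proj (J' ∪ supp xs) (∇ (clientLoss (data i)) xs)‖ ^ 2
        ≤ ‖proj (J ∪ supp xs) (∇ (clientLoss (data i)) xs)‖ ^ 2 := by
    intro i
    obtain ⟨J, hJ, hmax⟩ := Finset.exists_max_image
      (Finset.univ.filter (fun J : Finset (Fin d) => J.card ≤ 2 * τ))
      (fun J => ‖proj (J ∪ supp xs) (∇ (clientLoss (data i)) xs)‖ ^ 2) ⟨∅, by simp⟩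
    exact ⟨J, by simpa using hJ, fun J' hJ' => hmax J' (by simpa using hJ')⟩
  choose J hJ hmax using hex
  refine ⟨fun i => ‖proj (J i ∪ supp xs) (∇ (clientLoss (data i)) xs)‖ ^ 2, hmax, ?_⟩
  -- Dissimilarity compares clients on a common index set, so the worst sets of all clients are
  -- merged; this is the source of the factor `2Nτ + τ*`.
  set I := Finset.univ.biUnion J ∪ supp xs with hI
  have hIc : (I.card : ℝ) ≤ 2 * N * τ + l0 xs := by
    have h1 : I.card ≤ N * (2 * τ) + l0 xs := by
      refine (Finset.card_union_le _ _).trans ?_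
      rw [card_supp]
      gcongr
      simpa using Finset.card_biUnion_le_card_mul Finset.univ J (2 * τ) (fun i _ => hJ i)
    calc (I.card : ℝ) ≤ ((N * (2 * τ) + l0 xs : ℕ) : ℝ) := by exact_mod_cast h1
      _ = _ := by push_cast; ring
  calc _ ≤ 1 / (N : ℝ) * ∑ i, ‖proj I (∇ (clientLoss (data i)) xs)‖ ^ 2 := by
        gcongr with i _
        exact norm_proj_sq_mono (Finset.union_subset_union_left
          (Finset.subset_biUnion_of_mem J (Finset.mem_univ i))) _
    _ ≤ Bdis ^ 2 * ‖proj I (∇ (globalLoss data) xs)‖ ^ 2 := by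
        rw [Finset.mul_sum]; exact hdis I
    _ ≤ Bdis ^ 2 * ((2 * N * τ + l0 xs) * t) := by
        gcongr
        rw [norm_proj_sq]
        calc _ ≤ ∑ l ∈ I, t := Finset.sum_le_sum (fun l _ => hgrad l)
          _ = I.card * t := by simp
          _ ≤ _ := by gcongr

/-! ### The law of an observation -/

instance {d : ℕ} (D : Measure (Vec d)) [IsProbabilityMeasure D] (xs : Vec d) :
    IsProbabilityMeasure (obsLaw D xs) := by
  unfold obsLaw; infer_instance

theorem labelKernel_apply {d : ℕ} (xs z : Vec d) :
    labelKernel xs z = ENNReal.ofReal (logisticProb (inner ℝ z xs)) • Measure.dirac (1 : ℝ)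
      + ENNReal.ofReal (1 - logisticProb (inner ℝ z xs)) • Measure.dirac (0 : ℝ) := rfl

theorem measurePreserving_fst_obsLaw {d : ℕ} (D : Measure (Vec d)) [IsProbabilityMeasure D]
    (xs : Vec d) : MeasurePreserving Prod.fst (obsLaw D xs) D :=
  ⟨measurable_fst, Measure.fst_compProd D (labelKernel xs)⟩

theorem ae_obsLaw {d : ℕ} (D : Measure (Vec d)) [IsProbabilityMeasure D] (xs : Vec d) {Kz : ℝ}
    (hz : ∀ᵐ z ∂D, ‖z‖ ≤ Kz) :
    ∀ᵐ o ∂(obsLaw D xs), ‖o.1‖ ≤ Kz ∧ 0 ≤ o.2 ∧ o.2 ≤ 1 := by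
  have h1 : ∀ᵐ o ∂(obsLaw D xs), ‖o.1‖ ≤ Kz :=
    (measurePreserving_fst_obsLaw D xs).quasiMeasurePreserving.ae hz
  have h2 : ∀ᵐ o ∂(obsLaw D xs), 0 ≤ o.2 ∧ o.2 ≤ 1 := by
    have hm : MeasurableSet {o : Vec d × ℝ | 0 ≤ o.2 ∧ o.2 ≤ 1} :=
      (measurableSet_le measurable_const measurable_snd).inter
        (measurableSet_le measurable_snd measurable_const)
    unfold obsLaw
    rw [Measure.ae_compProd_iff hm]
    refine Filter.Eventually.of_forall (fun z => ?_)
    rw [labelKernel_apply, ae_add_measure_iff]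
    constructor <;> refine Measure.ae_smul_measure ?_ _ <;> rw [ae_dirac_eq] <;> simp
  filter_upwards [h1, h2] with o a b using ⟨a, b⟩

theorem measurable_obsGrad_apply {d : ℕ} (xs : Vec d) (l : Fin d) :
    Measurable (fun o : Vec d × ℝ => obsGrad o xs l) := by
  have h1 : Measurable (fun o : Vec d × ℝ => logisticProb (inner ℝ o.1 xs)) :=
    (continuous_logisticProb.comp (by fun_prop)).measurable
  have h2 : Measurable (fun o : Vec d × ℝ => o.1 l) :=
    (Continuous.measurable (by fun_prop : Continuous (fun z : Vec d => z l))).comp measurable_fst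
  simp only [obsGrad, PiLp.smul_apply, smul_eq_mul]
  exact (h1.sub measurable_snd).mul h2

theorem abs_apply_le_norm {d : ℕ} (x : Vec d) (l : Fin d) : |x l| ≤ ‖x‖ := by
  simpa using PiLp.norm_apply_le x l

/-- Given `z`, the label has mean `logisticProb (inner ℝ z xs)`, so the score at the true parameter
is centred already conditionally on the feature. -/
theorem integral_obsGrad_apply {d : ℕ} (D : Measure (Vec d)) [IsProbabilityMeasure D]
    (xs : Vec d) {Kz : ℝ} (hz : ∀ᵐ z ∂D, ‖z‖ ≤ Kz) (l : Fin d) :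
    ∫ o, obsGrad o xs l ∂(obsLaw D xs) = 0 := by
  have hint : Integrable (fun o : Vec d × ℝ => obsGrad o xs l) (obsLaw D xs) := by
    refine Integrable.of_bound (measurable_obsGrad_apply xs l).aestronglyMeasurable Kz ?_
    filter_upwards [ae_obsLaw D xs hz] with o ho
    exact (abs_apply_le_norm _ l).trans (norm_obsGrad_le ho.1 ho.2 xs)
  unfold obsLaw at hint ⊢
  rw [Measure.integral_compProd hint]
  refine (integral_congr_ae (Filter.Eventually.of_forall (fun z => ?_))).trans (integral_zero' _ _)
  have h0 := logisticProb_nonneg (inner ℝ z xs)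
  have h1 := logisticProb_le_one (inner ℝ z xs)
  have hi : ∀ c : ℝ, Integrable (fun y : ℝ => obsGrad (z, y) xs l) (Measure.dirac c) :=
    fun c => integrable_dirac (by simp)
  simp only [labelKernel_apply]
  rw [integral_add_measure ((hi 1).smul_measure ENNReal.ofReal_ne_top)
    ((hi 0).smul_measure ENNReal.ofReal_ne_top), integral_smul_measure, integral_smul_measure,
    integral_dirac, integral_dirac, ENNReal.toReal_ofReal h0,
    ENNReal.toReal_ofReal (by linarith)]
  simp only [obsGrad, PiLp.smul_apply, smul_eq_mul, Pi.zero_apply]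
  ring

/-! ### Second moments -/

theorem measurable_inner_left {d : ℕ} (v : Vec d) : Measurable (fun z : Vec d => inner ℝ z v) :=
  Continuous.measurable (by fun_prop)

theorem integrable_inner_mul_inner {d : ℕ} (D : Measure (Vec d)) [IsProbabilityMeasure D] {Kz : ℝ}
    (hz : ∀ᵐ z ∂D, ‖z‖ ≤ Kz) (u v : Vec d) :
    Integrable (fun z => inner ℝ z u * inner ℝ z v) D := by
  refine Integrable.of_bound
    ((measurable_inner_left u).mul (measurable_inner_left v)).aestronglyMeasurable
    ((Kz * ‖u‖) * (Kz * ‖v‖)) ?_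
  filter_upwards [hz] with z hz
  rw [norm_mul]
  have hK : 0 ≤ Kz := (norm_nonneg z).trans hz
  have h : ∀ w : Vec d, ‖inner ℝ z w‖ ≤ Kz * ‖w‖ := fun w =>
    (norm_inner_le_norm z w).trans (by gcongr)
  gcongr
  · exact h u
  · exact h v

/-- Empirical minus true second moments, as a bilinear form. -/
noncomputable def momentDeviation {d B : ℕ} (D : Measure (Vec d)) [IsProbabilityMeasure D] {Kz : ℝ}
    (hz : ∀ᵐ z ∂D, ‖z‖ ≤ Kz) (data : Fin B → Vec d × ℝ) : Vec d →ₗ[ℝ] Vec d →ₗ[ℝ] ℝ :=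
  LinearMap.mk₂ ℝ
    (fun u v => 1 / (B : ℝ) * ∑ j, inner ℝ (data j).1 u * inner ℝ (data j).1 v
      - ∫ z, inner ℝ z u * inner ℝ z v ∂D)
    (fun u u' v => by
      simp only [inner_add_right, add_mul, Finset.sum_add_distrib, mul_add]
      rw [integral_add (integrable_inner_mul_inner D hz u v)
        (integrable_inner_mul_inner D hz u' v)]
      ring)
    (fun c u v => by
      simp only [inner_smul_right, mul_assoc, ← Finset.mul_sum, integral_const_mul, smul_eq_mul]
      ring)
    (fun u v v' => by
      simp only [inner_add_right, Finset.sum_add_distrib, mul_add]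
      rw [integral_add (integrable_inner_mul_inner D hz u v)
        (integrable_inner_mul_inner D hz u v')]
      ring)
    (fun c u v => by
      simp only [inner_smul_right, mul_left_comm _ c, ← Finset.mul_sum, integral_const_mul,
        smul_eq_mul]
      ring)

theorem momentDeviation_comm {d B : ℕ} (D : Measure (Vec d)) [IsProbabilityMeasure D] {Kz : ℝ}
    (hz : ∀ᵐ z ∂D, ‖z‖ ≤ Kz) (data : Fin B → Vec d × ℝ) (u v : Vec d) :
    momentDeviation D hz data u v = momentDeviation D hz data v u := by
  simp only [momentDeviation, LinearMap.mk₂_apply, mul_comm]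

theorem momentDeviation_self {d B : ℕ} (D : Measure (Vec d)) [IsProbabilityMeasure D] {Kz : ℝ}
    (hz : ∀ᵐ z ∂D, ‖z‖ ≤ Kz) (data : Fin B → Vec d × ℝ) (v : Vec d) :
    momentDeviation D hz data v v = empMoment data v - ∫ z, inner ℝ z v ^ 2 ∂D := by
  simp only [momentDeviation, LinearMap.mk₂_apply, empMoment, sq]

/-! ### The good event -/

/-- For `‖a‖ ≤ 2` the squared inner product lies in `[0, 4 Kz²]` and has mean at most `4 lamMax`;
Bernstein's denominator is then `4 · 4 lamMax · 4 Kz²`. -/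
theorem measure_empMoment_deviation_le {d N B : ℕ} (hB : 0 < B) (D : Fin N → Measure (Vec d))
    [∀ i, IsProbabilityMeasure (D i)] (xs : Vec d) {Kz lamMax ε : ℝ}
    (hz : ∀ i, ∀ᵐ z ∂(D i), ‖z‖ ≤ Kz) (hK : 0 < Kz) (hL : 0 < lamMax) (hε : 0 < ε)
    (hεL : ε ≤ 8 * lamMax) (i : Fin N) (a : Vec d) (ha : ‖a‖ ≤ 2)
    (hmean : ∫ z, inner ℝ z a ^ 2 ∂(D i) ≤ lamMax * ‖a‖ ^ 2) :
    dataLaw B D xs {data | ε ≤ |empMoment (data i) a - ∫ z, inner ℝ z a ^ 2 ∂(D i)|}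
      ≤ ENNReal.ofReal (2 * Real.exp (-(B * ε ^ 2 / (64 * lamMax * Kz ^ 2)))) := by
  have hf : Measurable (fun o : Vec d × ℝ => inner ℝ o.1 a ^ 2) :=
    ((measurable_inner_left a).comp measurable_fst).pow_const 2
  have hmp : ∫ o, inner ℝ o.1 a ^ 2 ∂(obsLaw (D i) xs) = ∫ z, inner ℝ z a ^ 2 ∂(D i) := by
    rw [← (measurePreserving_fst_obsLaw (D i) xs).map_eq, integral_map measurable_fst.aemeasurable
      ((measurable_inner_left a).pow_const 2).aestronglyMeasurable,
      (measurePreserving_fst_obsLaw (D i) xs).map_eq]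
  have hasq : ‖a‖ ^ 2 ≤ 4 := by nlinarith [norm_nonneg a]
  have h := measure_abs_mean_sub_ge_le (B := B) (fun i => obsLaw (D i) xs) i hB
    (fun o => inner ℝ o.1 a ^ 2) hf (4 * Kz ^ 2) (4 * lamMax) ε (by positivity) (by positivity) hε
    (by linarith) (by
      filter_upwards [ae_obsLaw (D i) xs (hz i)] with o ho
      refine ⟨sq_nonneg _, ?_⟩
      have h1 : |inner ℝ o.1 a| ≤ Kz * 2 :=
        (abs_real_inner_le_norm _ _).trans (by gcongr; exact ho.1)
      calc inner ℝ o.1 a ^ 2 = |inner ℝ o.1 a| ^ 2 := (sq_abs _).symm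
        _ ≤ (Kz * 2) ^ 2 := by gcongr
        _ = _ := by ring) (by
      rw [hmp]
      refine hmean.trans ?_
      nlinarith)
  rw [hmp] at h
  refine h.trans (le_of_eq ?_)
  congr 4
  ring

theorem measurable_empMoment {d N B : ℕ} (i : Fin N) (a : Vec d) :
    Measurable (fun data : Fin N → Fin B → Vec d × ℝ => empMoment (data i) a) := by
  unfold empMoment
  refine (Finset.measurable_sum _ (fun j _ => ?_)).const_mul _
  exact ((measurable_inner_left a).comp (measurable_fst.comp
    ((measurable_pi_apply j).comp (measurable_pi_apply i)))).pow_const 2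

theorem gradient_globalLoss_apply {d N B : ℕ} (data : Fin N → Fin B → Vec d × ℝ) (x : Vec d)
    (l : Fin d) :
    (∇ (globalLoss data) x) l = 1 / ((N : ℝ) * B) * ∑ i, ∑ j, obsGrad (data i j) x l := by
  rw [gradient_globalLoss, ← Finset.smul_sum, smul_smul]
  simp only [PiLp.smul_apply, smul_eq_mul, WithLp.ofLp_sum, Finset.sum_apply]
  congr 1
  ring

theorem natCast_mul_ofReal (n : ℕ) (x : ℝ) :
    (n : ENNReal) * ENNReal.ofReal x = ENNReal.ofReal (n * x) := by
  rw [ENNReal.ofReal_mul (by positivity), ENNReal.ofReal_natCast]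

/-- The union bound over clients and net points. With `N ≤ d`, `25 ≤ d ^ 5` and `s ≤ 3τ` there are
at most `d ^ (1 + 6s) ≤ d ^ (19τ)` events, and the exponent `21τ log d` leaves `d ^ (-2τ)`. -/
theorem card_mul_exp_le {d N τ s n : ℕ} (hd : 2 ≤ d) (hN : N ≤ d) (hτ : 1 ≤ τ) (hs : s ≤ 3 * τ)
    (hn : n ≤ d ^ s * 25 ^ s) {e : ℝ} (he : 21 * τ * Real.log d ≤ e) :
    (N : ℝ) * (n * (2 * Real.exp (-e))) ≤ 2 / (d : ℝ) ^ 2 := by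
  have hd0 : (0 : ℝ) < d := by positivity
  have h1 : N * n ≤ d ^ (19 * τ) := by
    have h25 : 25 ≤ d ^ 5 := le_trans (by norm_num) (Nat.pow_le_pow_left hd 5)
    calc N * n ≤ d * (d ^ s * (d ^ 5) ^ s) :=
          Nat.mul_le_mul hN (hn.trans (Nat.mul_le_mul_left _ (Nat.pow_le_pow_left h25 _)))
      _ = d ^ (1 + (s + 5 * s)) := by ring
      _ ≤ d ^ (19 * τ) := Nat.pow_le_pow_right (by omega) (by omega)
  have h2 : Real.exp (-e) ≤ ((d : ℝ) ^ (21 * τ))⁻¹ := by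
    rw [Real.exp_neg]
    refine inv_anti₀ (by positivity) ?_
    refine le_trans (le_of_eq ?_) (Real.exp_le_exp.mpr he)
    rw [show (21 : ℝ) * τ * Real.log d = ((21 * τ : ℕ) : ℝ) * Real.log d by push_cast; ring,
      Real.exp_nat_mul, Real.exp_log hd0]
  have h3 : ((N * n : ℕ) : ℝ) ≤ (d : ℝ) ^ (19 * τ) := by exact_mod_cast h1
  have h4 : (d : ℝ) ^ 2 ≤ (d : ℝ) ^ (2 * τ) :=
    pow_le_pow_right₀ (by exact_mod_cast (by omega : 1 ≤ d)) (by omega)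
  calc (N : ℝ) * (n * (2 * Real.exp (-e))) = 2 * (((N * n : ℕ) : ℝ) * Real.exp (-e)) := by
        push_cast; ring
    _ ≤ 2 * ((d : ℝ) ^ (19 * τ) * ((d : ℝ) ^ (21 * τ))⁻¹) := by gcongr
    _ = 2 * ((d : ℝ) ^ (2 * τ))⁻¹ := by
        rw [show 21 * τ = 19 * τ + 2 * τ by ring, pow_add]
        field_simp
    _ ≤ 2 * ((d : ℝ) ^ 2)⁻¹ := by gcongr
    _ = _ := by ring

/-- The event on which restricted second moments, the gradient at `xs` and the features are
controlled. -/
theorem exists_good_event {d N B τ : ℕ} (hd : 2 ≤ d) (hN : 0 < N) (hNd : N ≤ d) (hB : 0 < B)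
    (hτ : 1 ≤ τ) (xs : Vec d) (hτs : l0 xs ≤ τ) (D : Fin N → Measure (Vec d))
    [∀ i, IsProbabilityMeasure (D i)] {Kz lamMin lamMax : ℝ} (hK : 0 < Kz)
    (hmin : 0 < lamMin) (hmax : lamMin ≤ lamMax) (hz : ∀ i, ∀ᵐ z ∂(D i), ‖z‖ ≤ Kz)
    (hmom : ∀ i, ∀ v : Vec d, l0 v ≤ 2 * τ + l0 xs →
      lamMin * ‖v‖ ^ 2 ≤ ∫ z, inner ℝ z v ^ 2 ∂(D i) ∧
        ∫ z, inner ℝ z v ^ 2 ∂(D i) ≤ lamMax * ‖v‖ ^ 2)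
    (hBlarge : 302400 * lamMax / lamMin ^ 2 * τ * Kz ^ 2 * Real.log d ≤ B) :
    ∃ E : Set (Fin N → Fin B → Vec d × ℝ), MeasurableSet E ∧
      ENNReal.ofReal (1 - 4 / (d : ℝ) ^ 2) ≤ dataLaw B D xs E ∧
      ∀ data ∈ E,
        (∀ i, ∀ v : Vec d, l0 v ≤ 2 * τ + l0 xs →
          4 / 5 * lamMin * ‖v‖ ^ 2 ≤ empMoment (data i) v ∧
            empMoment (data i) v ≤ 6 / 5 * lamMax * ‖v‖ ^ 2) ∧
        (∀ l, (∇ (globalLoss data) xs) l ^ 2 ≤ 6 * Kz ^ 2 * Real.log d / (N * B)) ∧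
        (∀ i j, ‖(data i j).1‖ ≤ Kz ∧ 0 ≤ (data i j).2 ∧ (data i j).2 ≤ 1) := by
  have hdr : (0 : ℝ) < d := by positivity
  have hBr : (0 : ℝ) < B := by exact_mod_cast hB
  have hNr : (0 : ℝ) < N := by exact_mod_cast hN
  have hlog : 0 < Real.log d := Real.log_pos (by exact_mod_cast (by omega : 1 < d))
  have hLmax : 0 < lamMax := hmin.trans_le hmax
  set s := 2 * τ + l0 xs with hs
  obtain ⟨A, hAc, hA2, hAs, hAM⟩ := exists_finset_control_sparse d s (by omega)
  -- The net loses a factor 3, so the deviation is `lamMin / 5` on all sparse vectors, as the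
  -- factors `4/5` and `6/5` require.
  set ε := lamMin / 15 with hε
  have hε0 : 0 < ε := by positivity
  -- Chosen so that Hoeffding's exponent is `3 log d`; the union over `d` coordinates leaves `2 /
  -- d²`.
  set t := √(6 * Kz ^ 2 * Real.log d / (N * B)) with ht
  have ht0 : 0 < t := Real.sqrt_pos.mpr (by positivity)
  have htsq : t ^ 2 = 6 * Kz ^ 2 * Real.log d / (N * B) := Real.sq_sqrt (by positivity)
  let P := dataLaw B D xs
  have hPdef : P = Measure.pi (fun i => Measure.pi (fun _ : Fin B => obsLaw (D i) xs)) := rfl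
  have hPprob : IsProbabilityMeasure P := by rw [hPdef]; infer_instance
  let bad₁ : Set (Fin N → Fin B → Vec d × ℝ) := ⋃ i, ⋃ a ∈ A,
    {data | ε ≤ |empMoment (data i) a - ∫ z, inner ℝ z a ^ 2 ∂(D i)|}
  let bad₂ : Set (Fin N → Fin B → Vec d × ℝ) := ⋃ l,
    {data | t * (N * B) ≤ |∑ i, ∑ j, obsGrad (data i j) xs l|}
  let good₃ : Set (Vec d × ℝ) := {o | ‖o.1‖ ≤ Kz ∧ 0 ≤ o.2 ∧ o.2 ≤ 1}
  let bad₃ : Set (Fin N → Fin B → Vec d × ℝ) := ⋃ i, ⋃ j, {data | data i j ∈ good₃ᶜ}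
  have hmeas₃ : MeasurableSet good₃ :=
    (measurableSet_le measurable_fst.norm measurable_const).inter
      ((measurableSet_le measurable_const measurable_snd).inter
        (measurableSet_le measurable_snd measurable_const))
  have hmeas : MeasurableSet (bad₁ ∪ bad₂ ∪ bad₃) := by
    refine (MeasurableSet.union ?_ ?_).union ?_
    · refine MeasurableSet.iUnion (fun i => A.measurableSet_biUnion (fun a _ => ?_))
      exact measurableSet_le measurable_const
        (continuous_abs.measurable.comp ((measurable_empMoment i a).sub_const _))
    · refine MeasurableSet.iUnion (fun l => ?_)
      refine measurableSet_le measurable_const (continuous_abs.measurable.comp ?_)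
      refine Finset.measurable_sum _ (fun i _ => Finset.measurable_sum _ (fun j _ => ?_))
      exact (measurable_obsGrad_apply xs l).comp
        ((measurable_pi_apply j).comp (measurable_pi_apply i))
    · refine MeasurableSet.iUnion (fun i => MeasurableSet.iUnion (fun j => ?_))
      exact ((measurable_pi_apply j).comp (measurable_pi_apply i)) hmeas₃.compl
  have hP₁ : P bad₁ ≤ ENNReal.ofReal (2 / (d : ℝ) ^ 2) := by
    set e := B * ε ^ 2 / (64 * lamMax * Kz ^ 2) with he
    -- The sample size constant is `302400 = 21 · 64 · 15²`.
    have he' : 21 * τ * Real.log d ≤ e := by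
      rw [he, hε, le_div_iff₀ (by positivity)]
      calc 21 * τ * Real.log d * (64 * lamMax * Kz ^ 2)
          = 302400 * lamMax / lamMin ^ 2 * τ * Kz ^ 2 * Real.log d * (lamMin / 15) ^ 2 := by
            field_simp; ring
        _ ≤ B * (lamMin / 15) ^ 2 := by gcongr
    calc P bad₁ ≤ ∑ _i : Fin N, ∑ _a ∈ A, ENNReal.ofReal (2 * Real.exp (-e)) := by
          refine (measure_iUnion_fintype_le _ _).trans (Finset.sum_le_sum (fun i _ => ?_))
          refine (measure_biUnion_finset_le _ _).trans (Finset.sum_le_sum (fun a ha => ?_))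
          exact measure_empMoment_deviation_le hB D xs hz hK hLmax hε0 (by rw [hε]; linarith) i a
            (hA2 a ha) (hmom i a (hAs a ha)).2
      _ = ENNReal.ofReal ((N : ℝ) * (A.card * (2 * Real.exp (-e)))) := by
          simp only [Finset.sum_const, Finset.card_univ, Fintype.card_fin, nsmul_eq_mul]
          rw [natCast_mul_ofReal, natCast_mul_ofReal]
      _ ≤ _ := ENNReal.ofReal_le_ofReal (card_mul_exp_le hd hNd hτ (by omega) hAc he')
  have hP₂ : P bad₂ ≤ ENNReal.ofReal (2 / (d : ℝ) ^ 2) := by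
    calc P bad₂ ≤ ∑ _l : Fin d, ENNReal.ofReal (2 * Real.exp (-(3 * Real.log d))) := by
          refine (measure_iUnion_fintype_le _ _).trans (Finset.sum_le_sum (fun l _ => ?_))
          have h := measure_abs_sum_ge_le (B := B) (fun i => obsLaw (D i) xs) hN hB
            (fun o => obsGrad o xs l) (measurable_obsGrad_apply xs l) Kz t hK ht0 (fun i => by
              filter_upwards [ae_obsLaw (D i) xs (hz i)] with o ho
              exact (abs_apply_le_norm _ l).trans (norm_obsGrad_le ho.1 ho.2 xs))
            (fun i => integral_obsGrad_apply (D i) xs (hz i) l)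
          refine h.trans (le_of_eq ?_)
          rw [htsq]
          congr 4
          field_simp
          norm_num
      _ = ENNReal.ofReal ((d : ℝ) * (2 * Real.exp (-(3 * Real.log d)))) := by
          simp only [Finset.sum_const, Finset.card_univ, Fintype.card_fin, nsmul_eq_mul]
          rw [natCast_mul_ofReal]
      _ = _ := by
          congr 1
          rw [Real.exp_neg, show (3 : ℝ) * Real.log d = ((3 : ℕ) : ℝ) * Real.log d by norm_num,
            Real.exp_nat_mul, Real.exp_log hdr]
          field_simp
  have hP₃ : P bad₃ = 0 := by
    refine measure_iUnion_null (fun i => measure_iUnion_null (fun j => ?_))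
    have hmp : MeasurePreserving (fun data : Fin N → Fin B → Vec d × ℝ => data i j) P
        (obsLaw (D i) xs) :=
      (measurePreserving_eval (fun _ : Fin B => obsLaw (D i) xs) j).comp
        (measurePreserving_eval (fun i => Measure.pi (fun _ : Fin B => obsLaw (D i) xs)) i)
    have h := hmp.measure_preimage hmeas₃.compl.nullMeasurableSet
    exact h.trans (ae_obsLaw (D i) xs (hz i))
  refine ⟨(bad₁ ∪ bad₂ ∪ bad₃)ᶜ, hmeas.compl, ?_, ?_⟩
  · have hbad : P (bad₁ ∪ bad₂ ∪ bad₃) ≤ ENNReal.ofReal (4 / (d : ℝ) ^ 2) := by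
      refine (measure_union_le _ _).trans ?_
      rw [hP₃, add_zero]
      refine (measure_union_le _ _).trans ((add_le_add hP₁ hP₂).trans (le_of_eq ?_))
      rw [← ENNReal.ofReal_add (by positivity) (by positivity)]
      congr 1
      ring
    change _ ≤ P _
    rw [prob_compl_eq_one_sub hmeas, ENNReal.ofReal_sub _ (by positivity), ENNReal.ofReal_one]
    exact tsub_le_tsub_left hbad 1
  · intro data hdata
    rw [Set.mem_compl_iff, Set.mem_union, Set.mem_union, not_or, not_or] at hdata
    obtain ⟨⟨h1, h2⟩, h3⟩ := hdata
    refine ⟨fun i v hv => ?_, fun l => ?_, fun i j => ?_⟩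
    · have hnet : ∀ a ∈ A, |momentDeviation (D i) (hz i) (data i) a a| ≤ ε := by
        intro a ha
        rw [momentDeviation_self]
        by_contra hcon
        exact h1 (Set.mem_iUnion.mpr ⟨i, Set.mem_iUnion₂.mpr ⟨a, ha, (not_le.mp hcon).le⟩⟩)
      have hdev := hAM _ (momentDeviation_comm (D i) (hz i) (data i)) ε hnet v hv
      rw [momentDeviation_self, abs_le] at hdev
      have hm := hmom i v hv
      have hmm : lamMin * ‖v‖ ^ 2 ≤ lamMax * ‖v‖ ^ 2 := by gcongr
      have he : 3 * ε * ‖v‖ ^ 2 = lamMin * ‖v‖ ^ 2 / 5 := by rw [hε]; ring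
      rw [he] at hdev
      constructor <;> linarith [hdev.1, hdev.2, hm.1, hm.2]
    · have h : |∑ i, ∑ j, obsGrad (data i j) xs l| ≤ t * (N * B) := by
        by_contra hcon
        exact h2 (Set.mem_iUnion.mpr ⟨l, (not_le.mp hcon).le⟩)
      rw [gradient_globalLoss_apply, ← htsq, mul_pow, ← sq_abs (∑ i, ∑ j, _)]
      calc _ ≤ (1 / ((N : ℝ) * B)) ^ 2 * (t * (N * B)) ^ 2 := by gcongr
        _ = t ^ 2 := by field_simp
    · by_contra hcon
      exact h3 (Set.mem_iUnion.mpr ⟨i, Set.mem_iUnion.mpr ⟨j, hcon⟩⟩)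

/-! ### Consequences of the parameter choices -/

theorem lt_of_thresholding_level {κ : ℝ} (hκ : 1 ≤ κ) {τ τs : ℕ} (hτ : 1 ≤ τ)
    (h : (16 / (√(12 * κ / (12 * κ - 1)) - 1) ^ 2 + 1) * τs ≤ (τ : ℝ)) : τs < τ := by
  rcases Nat.eq_zero_or_pos τs with h0 | h0
  · omega
  have h1 : 1 < √(12 * κ / (12 * κ - 1)) := by
    rw [Real.lt_sqrt zero_le_one, one_pow, lt_div_iff₀ (by linarith)]
    linarith
  have h2 : 0 < 16 / (√(12 * κ / (12 * κ - 1)) - 1) ^ 2 := by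
    have : 0 < √(12 * κ / (12 * κ - 1)) - 1 := by linarith
    positivity
  have h3 : (0 : ℝ) < τs := by exact_mod_cast h0
  have h4 : (τs : ℝ) < τ := by nlinarith
  exact_mod_cast h4

/-- Otherwise the features vanish almost surely, against the lower moment bound at a basis vector.
Positivity of `Kz` is needed since the sample size condition would be vacuous without it. -/
theorem feature_bound_pos {d : ℕ} (hd : 0 < d) (D : Measure (Vec d)) [IsProbabilityMeasure D]
    {Kz lamMin : ℝ} (hz : ∀ᵐ z ∂D, ‖z‖ ≤ Kz) (hmin : 0 < lamMin)
    (h : ∀ v : Vec d, l0 v ≤ 1 → lamMin * ‖v‖ ^ 2 ≤ ∫ z, inner ℝ z v ^ 2 ∂D) : 0 < Kz := by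
  by_contra hcon
  let v : Vec d := EuclideanSpace.single ⟨0, hd⟩ 1
  have hv : l0 v ≤ 1 := l0_le_card (I := {⟨0, hd⟩}) (fun l hl => by
    have : l ≠ ⟨0, hd⟩ := by simpa using hl
    simp [v, this])
  have h1 := h v hv
  have h2 : ∫ z, inner ℝ z v ^ 2 ∂D = 0 := by
    refine (integral_congr_ae ?_).trans (integral_zero' _ _)
    filter_upwards [hz] with z hz
    have : z = 0 := norm_le_zero_iff.mp (hz.trans (not_lt.mp hcon))
    simp [this]
  have h3 : ‖v‖ = 1 := by simp [v]
  rw [h2, h3] at h1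
  linarith

/-- The left side factors as `(1 - exp(-NB)) (1 - 8/d²)`. As `exp(-NB) ≤ 1/2`, at least half of
`8/d²` survives, which covers the failure probability `4/d²` of the good event. -/
theorem probability_bound_le {N B d : ℕ} (hN : 0 < N) (hB : 0 < B) (hd : 0 < d) :
    1 - Real.exp (-((1 : ℝ) * N * B)) - 8 * Real.exp (-(2 * Real.log d))
      + 8 / (Real.exp ((1 : ℝ) * N * B) * Real.exp (2 * Real.log d)) ≤ 1 - 4 / (d : ℝ) ^ 2 := by
  have hdr : (0 : ℝ) < d := by exact_mod_cast hd
  have hsq : Real.exp (2 * Real.log d) = (d : ℝ) ^ 2 := by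
    rw [show (2 : ℝ) * Real.log d = ((2 : ℕ) : ℝ) * Real.log d by norm_num, Real.exp_nat_mul,
      Real.exp_log hdr]
  have hNB : (1 : ℝ) ≤ 1 * N * B := by
    rw [one_mul]
    exact_mod_cast Nat.mul_pos hN hB
  have he : 2 ≤ Real.exp ((1 : ℝ) * N * B) := by
    linarith [Real.add_one_le_exp ((1 : ℝ) * N * B)]
  rw [Real.exp_neg, Real.exp_neg, hsq]
  set e := Real.exp ((1 : ℝ) * N * B)
  have h1 : e⁻¹ ≤ 2⁻¹ := inv_anti₀ (by norm_num) he
  have h0 : 0 < e⁻¹ := by positivity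
  have h2 : 8 / (e * (d : ℝ) ^ 2) = 8 * e⁻¹ * ((d : ℝ) ^ 2)⁻¹ := by field_simp
  have h3 : 0 < ((d : ℝ) ^ 2)⁻¹ := by positivity
  rw [h2, div_eq_mul_inv]
  nlinarith

theorem restrictedError_zero_le {d N B : ℕ} (hB : 0 < B) (Clow Cup : ℝ) (xs : Vec d) (τ K : ℕ)
    (γ : ℝ) (b : ℕ → ℕ) (data : Fin N → Fin B → Vec d × ℝ) (x0 : Vec d) :
    restrictedError Clow Cup xs τ K γ b data x0 0 ≤ ‖x0 - xs‖ ^ 2 := by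
  have : Nonempty (Fin B) := ⟨⟨0, hB⟩⟩
  exact Finset.expect_le Finset.univ_nonempty (fun S _ =>
    Set.indicator_le_self' (fun _ _ => by positivity) S)

theorem restrictedError_nonneg {d N B : ℕ} (Clow Cup : ℝ) (xs : Vec d) (τ K : ℕ)
    (γ : ℝ) (b : ℕ → ℕ) (data : Fin N → Fin B → Vec d × ℝ) (x0 : Vec d) (T : ℕ) :
    0 ≤ restrictedError Clow Cup xs τ K γ b data x0 T :=
  Finset.expect_nonneg (fun _ _ => Set.indicator_nonneg (fun _ _ => by positivity) _)

/-- The constant in front of the statistical error. -/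
noncomputable def errorConst (ρ l : ℝ) : ℝ :=
  4 * (1 + 1 / (ρ / (12 * l))) * (1 / (6 * l)) ^ 2 / (ρ / (12 * l))

end FedLogistic

/-! ### Assembly of the error bound -/

theorem corollary4p1p4 :
    ∃ C₆ C₉ C₁₀ : ℝ, 0 < C₆ ∧ 0 < C₉ ∧ 0 < C₁₀ ∧
    ∀ lamMin lamMax : ℝ, 0 < lamMin → lamMin ≤ lamMax →
    ∃ C₇ : ℝ, 0 < C₇ ∧
    ∀ Clow Cup : ℝ, 0 < Clow → Clow ≤ Cup →
    ∃ C : ℝ, 0 < C ∧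
    ∀ (d N B τ K : ℕ), 2 ≤ d → 1 ≤ N → N ≤ d → 1 ≤ τ → 1 ≤ K →
    ∀ (xstar x0 : FedLogistic.Vec d) (τstar : ℕ),
      τstar = FedLogistic.l0 xstar → FedLogistic.l0 x0 ≤ τ →
    -- the feature distributions of the clients
    ∀ (D : Fin N → Measure (FedLogistic.Vec d)) (Kz : ℝ),
      (∀ i, IsProbabilityMeasure (D i)) →
      (∀ i, ∀ᵐ z ∂(D i), ‖z‖ ≤ Kz) →
      (∀ i, ∀ v : FedLogistic.Vec d, FedLogistic.l0 v ≤ 2 * τ + τstar →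
        lamMin * ‖v‖ ^ 2 ≤ ∫ z, (inner ℝ z v) ^ 2 ∂(D i) ∧
          ∫ z, (inner ℝ z v) ^ 2 ∂(D i) ≤ lamMax * ‖v‖ ^ 2) →
      C₇ * τ * Kz ^ 2 * Real.log d ≤ B →
    -- the parameters of the algorithm
    ∀ (ρ l κ α θ Γ γ : ℝ) (b : ℕ → ℕ),
      ρ = 4 / 5 * Clow * lamMin → l = 6 / 5 * Cup * lamMax → κ = l / ρ →
      α = 2 * √(τstar : ℝ) / √((τ : ℝ) - τstar) →
      (16 / (√(12 * κ / (12 * κ - 1)) - 1) ^ 2 + 1) * τstar ≤ (τ : ℝ) →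
      θ = (1 + 2 * α) ^ 2 * (1 - 1 / (12 * κ)) → θ < 1 →
      γ = 1 / (6 * l) → 0 < Γ → (∀ t, b t = ⌈Γ / θ ^ t⌉₊) →
    ∀ Bdis : ℝ, 1 < Bdis →
    ∃ (T₀ : ℕ) (E : Set (Fin N → Fin B → FedLogistic.Vec d × ℝ)),
      MeasurableSet E ∧
      ENNReal.ofReal
          (1 - Real.exp (-(C₆ * N * B)) - C₉ * Real.exp (-(C₁₀ * Real.log d))
            + C₉ / (Real.exp (C₆ * N * B) * Real.exp (C₁₀ * Real.log d)))
        ≤ FedLogistic.dataLaw B D xstar E ∧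
      ∀ data ∈ E, FedLogistic.LocallyDissimilarAt data Bdis xstar →
        ∀ T, T₀ ≤ T →
          -- the expectation over the runs that satisfy the curvature condition
          (𝔼 S : FedLogistic.Batches N B K b T,
              Set.indicator
                {S | FedLogistic.CurvatureAlong Clow Cup xstar τ K γ b data x0 S}
                (fun S => ‖FedLogistic.fedIterHT τ K γ b data x0 T S - xstar‖ ^ 2) S
            ≤ C * ((2 * N * τ + τstar) * Bdis ^ 2 * Kz ^ 2 * Real.log d / (N * B))) ∧
          -- the full expectation, if every run satisfies it
          ((∀ S, FedLogistic.CurvatureAlong Clow Cup xstar τ K γ b data x0 (T := T) S) →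
            𝔼 S : FedLogistic.Batches N B K b T,
                ‖FedLogistic.fedIterHT τ K γ b data x0 T S - xstar‖ ^ 2
              ≤ C * ((2 * N * τ + τstar) * Bdis ^ 2 * Kz ^ 2 * Real.log d / (N * B))) := by
  refine ⟨1, 8, 2, one_pos, by norm_num, by norm_num, ?_⟩
  intro lamMin lamMax hmin hmax
  have hLmax : 0 < lamMax := hmin.trans_le hmax
  refine ⟨302400 * lamMax / lamMin ^ 2, by positivity, ?_⟩
  intro Clow Cup hClow hCup
  have hCup0 : 0 < Cup := hClow.trans_le hCup
  -- With `u = ρ / (12 l)`, the recursion settles at `errorConst ρ l * 6 / u` times the statistical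
  -- error; the added 1 pays for the transient.
  refine ⟨FedLogistic.errorConst (4 / 5 * Clow * lamMin) (6 / 5 * Cup * lamMax) * 6
    / (4 / 5 * Clow * lamMin / (12 * (6 / 5 * Cup * lamMax))) + 1,
    by unfold FedLogistic.errorConst; positivity, ?_⟩
  intro d N B τ K hd hN hNd hτ hK xs x0 τs hτs hx0 D Kz hD hz hmom hBlarge ρ l κ α θ Γ γ b hρ hl hκ
    hα hlevel hθ hθ1 hγ hΓ hb Bdis hBdis
  subst hτs
  rw [← hρ, ← hl]
  have hρ0 : 0 < ρ := by rw [hρ]; positivity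
  have hl0 : 0 < l := by rw [hl]; positivity
  have hprod : Clow * lamMin ≤ Cup * lamMax := by gcongr
  have hρl : 3 * ρ ≤ 2 * l := by rw [hρ, hl]; linarith
  set u := ρ / (12 * l) with hu
  have hu0 : 0 < u := by positivity
  have hu1 : u ≤ 1 / 18 := by
    rw [hu, div_le_iff₀ (by positivity)]
    linarith
  have hκ1 : 1 ≤ κ := by
    rw [hκ, one_le_div hρ0]
    linarith
  have hκu : 1 / (12 * κ) = u := by
    rw [hκ, hu]; field_simp
  have hτlt : FedLogistic.l0 xs < τ := FedLogistic.lt_of_thresholding_level hκ1 hτ hlevel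
  have hα0 : 0 ≤ α := by rw [hα]; positivity
  have hH : FedLogistic.htFactor τ (FedLogistic.l0 xs) = 1 + α := by
    rw [hα, FedLogistic.htFactor]
  -- `θ` contains `(1 + 2α)²`, whereas the contraction needs only `(1 + α)²`.
  have hfac : FedLogistic.htFactor τ (FedLogistic.l0 xs) ^ 2 * (1 - u) ≤ 1 := by
    rw [hH]
    refine le_trans ?_ hθ1.le
    rw [hθ, hκu]
    gcongr
    · linarith
    · linarith
  have hθ0 : 0 < θ := by
    rw [hθ, hκu]
    have : 0 < 1 - u := by linarith
    positivity
  have hKz : 0 < Kz := FedLogistic.feature_bound_pos (by omega) (D ⟨0, hN⟩) (hz _) hmin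
    (fun v hv => (hmom _ v (by omega)).1)
  have hlog : 0 < Real.log d := Real.log_pos (by exact_mod_cast (by omega : 1 < d))
  have hτr : (0 : ℝ) < τ := by exact_mod_cast hτ
  have hNr : (0 : ℝ) < N := by exact_mod_cast hN
  have hBr : (0 : ℝ) < B := lt_of_lt_of_le (by positivity) hBlarge
  have hB : 0 < B := by exact_mod_cast hBr
  obtain ⟨E, hE, hPE, hgood⟩ := FedLogistic.exists_good_event hd hN hNd hB hτ xs hτlt.le D hKz hmin
    hmax hz hmom hBlarge
  set X := (2 * N * τ + (FedLogistic.l0 xs : ℝ)) * Bdis ^ 2 * Kz ^ 2 * Real.log d / (N * B) with hX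
  have hX0 : 0 < X := by positivity
  set c := FedLogistic.errorConst ρ l with hc
  have hc0 : 0 ≤ c := by rw [hc, FedLogistic.errorConst]; positivity
  -- The midpoint between 1 and the larger of the two rates lies strictly between them.
  set φ := (max (1 - u) θ + 1) / 2 with hφ
  have hmax1 : max (1 - u) θ < 1 := max_lt (by linarith) hθ1
  have hφ1 : φ < 1 := by rw [hφ]; linarith
  have hφu : 1 - u < φ := by
    have := le_max_left (1 - u) θ
    rw [hφ]; linarith
  have hφθ : θ ≤ φ := by
    have := le_max_right (1 - u) θ
    rw [hφ]; linarith
  have hφ0 : 0 < φ := hθ0.trans_le hφθ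
  -- The coefficient of the transient, with the initial error bounded by a quantity free of the
  -- data; this is why `T₀` can be chosen before the data.
  set L := ‖x0 - xs‖ ^ 2 + c * (Kz ^ 2 / Γ) / (φ - (1 - u)) with hL
  have hlim : Filter.Tendsto (fun T : ℕ => L * φ ^ T) Filter.atTop (nhds 0) := by
    simpa using (tendsto_pow_atTop_nhds_zero_of_lt_one hφ0.le hφ1).const_mul L
  obtain ⟨T₀, hT₀⟩ := Filter.eventually_atTop.mp (hlim.eventually (gt_mem_nhds hX0))
  refine ⟨T₀, E, hE, (ENNReal.ofReal_le_ofReal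
    (FedLogistic.probability_bound_le hN hB (by omega))).trans hPE, ?_⟩
  intro data hdata hdis T hT
  obtain ⟨hcov, hgrad, hbd⟩ := hgood data hdata
  obtain ⟨M, hM, hMb⟩ := FedLogistic.exists_client_gradient_bounds hN τ hdis (by positivity) hgrad
  have hrec : ∀ T, FedLogistic.restrictedError Clow Cup xs τ K γ b data x0 (T + 1)
      ≤ (1 - u) * FedLogistic.restrictedError Clow Cup xs τ K γ b data x0 T
        + c * (6 * X + Kz ^ 2 / Γ * θ ^ T) := by
    intro T
    have hθT : 0 < Γ / θ ^ T := by positivity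
    have hbT : 0 < b T := by rw [hb]; exact Nat.ceil_pos.mpr hθT
    rw [hγ]
    refine FedLogistic.restrictedError_succ_le_of_moments hN hB hK hτlt hx0 hClow hl0 hu hu0 hu1
      hfac (fun i j => (hbd i j).1) (fun i j => (hbd i j).2) (fun i v hv => ?_) (fun i v hv => ?_)
      hM (hMb.trans (le_of_eq ?_)) T hbT ?_
    · calc ρ * ‖v‖ ^ 2 = Clow * (4 / 5 * lamMin * ‖v‖ ^ 2) := by rw [hρ]; ring
        _ ≤ _ := by gcongr; exact (hcov i v hv).1
    · calc _ ≤ Cup * (6 / 5 * lamMax * ‖v‖ ^ 2) := by gcongr; exact (hcov i v hv).2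
        _ = _ := by rw [hl]; ring
    · rw [hX]; ring
    · have hle : Γ / θ ^ T ≤ (b T : ℝ) := by rw [hb]; exact Nat.le_ceil _
      exact (one_div_le_one_div_of_le hθT hle).trans (one_div_div _ _).le
  have hbound : FedLogistic.restrictedError Clow Cup xs τ K γ b data x0 T
      ≤ (c * 6 / u + 1) * X := by
    have h1 := FedLogistic.le_geometric_of_recursion (by linarith) (by linarith) hφu hθ0.le hφθ hc0
      (by positivity) (by positivity)
      (FedLogistic.restrictedError_nonneg Clow Cup xs τ K γ b data x0 0) hrec T
    have h2 : (FedLogistic.restrictedError Clow Cup xs τ K γ b data x0 0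
        + c * (Kz ^ 2 / Γ) / (φ - (1 - u))) * φ ^ T ≤ L * φ ^ T := by
      rw [hL]
      gcongr
      exact FedLogistic.restrictedError_zero_le hB Clow Cup xs τ K γ b data x0
    have h3 : c * (6 * X) / (1 - (1 - u)) = c * 6 / u * X := by
      rw [sub_sub_cancel]; ring
    linarith [hT₀ T hT]
  -- If every run satisfies the curvature condition, the indicator is constantly 1.
  refine ⟨hbound, fun hall => ?_⟩
  refine le_trans (le_of_eq (Finset.expect_congr rfl (fun S _ => ?_))) hbound
  exact (Set.indicator_of_mem (s := {S | FedLogistic.CurvatureAlong Clow Cup xs τ K γ b data x0 S})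
    (hall S) (fun S => ‖FedLogistic.fedIterHT τ K γ b data x0 T S - xs‖ ^ 2)).symm
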